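/- **Conventions.** Manifolds are smooth, Hausdorff, second countable and without boundary. On a symplectic manifold $(M,\omega)$ of dimension $2n$ put $df(v)=\omega(v,X_f)$ and $\{f,g\}=df(X_g)=\omega(X_g,X_f)$. On a manifold with a bracket $\{f,g\}=\Lambda(df,dg)$ given by a field $\Lambda$ of bilinear forms on the cotangent spaces, a first integral of the Hamiltonian system $\dot f=\{f,h\}$ is a smooth $f$ with $\{f,h\}=0$. An algebra $\mathcal F$ of smooth functions closed under the bracket is *complete* if there are constants $l,r$ such that, on an open dense set of points $x$, the space $F_x=\mathrm{span}\{df(x): f\in\mathcal F\}$ has dimension $l$, the kernel of $\Lambda_x|_{F_x}$ has dimension $r$, and $l+r=\dim M+\mathrm{corank}\,\Lambda_x$. The system is *completely integrable in the noncommutative sense* if it has a complete algebra of first integrals. It is *Liouville integrable* if it has $N$ pairwise commuting smooth first integrals with differentials independent on an open dense set, on which $2N=\dim M+\mathrm{corank}\,\Lambda_x$ (so $N=n$ for a symplectic manifold of dimension $2n$). A Liouville integrable system on $(M^{2n},\omega)$ is *$\mathbb T^n$-dense completely integrable* if, for some choice of the integrals and of the open dense set $U$ on which they are independent, every point of $U$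 lies in a toroidal domain in which the system is $\mathbb T^n$-dense. Here a toroidal domain is an open set with coordinates $(\varphi \bmod 2\pi, I)\in\mathbb T^n\times B_\sigma$, where $B_\sigma\subset\mathbb R^n$ is the open ball of radius $\sigma>0$ about $0$, in which $\omega=\sum_i dI_i\wedge d\varphi_i$ and $h=H(I)$. The system is $\mathbb T^n$-dense in it if for a dense set of $I_0\in B_\sigma$ the trajectories $\varphi(t)=\varphi_0+t\,\partial H/\partial I(I_0)$ are dense in the torus $I=I_0$. **Lemma 5.1.** Let a connected Lie group $G$ with Lie algebra $\mathfrak g$ act smoothly and effectively on a symplectic manifold $(M,\omega)$ of dimension $2n$, and let the action be Hamiltonian: $G$ acts by symplectomorphisms, and there is a moment map $\Phi:M\to\mathfrak g^*$ such that the functions $\phi_\xi=(\Phi,\xi)$, $\xi\in\mathfrak g$, are smooth, the infinitesimal generator of the action of $\xi$ is $X_{\phi_\xi}$, and $\phi_{[\xi_1,\xi_2]}=\{\phi_{\xi_1},\phi_{\xi_2}\}$. Let $h$ be a smooth $G$-invariant function on $M$. (i) If the Hamiltonian system of $h$ is completely integrable by means of $G$-invariant first integrals, in the noncommutative or in the Liouville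 sense, then $G$ is commutative. If moreover the action is free, then the following reduced systems are completely integrable, in the noncommutative sense if the original system is so by means of $G$-invariant integrals, and in the Liouville sense if the original system is so by means of $G$-invariant integrals. * The reduced system on the Poisson manifold $M/G$, whose bracket and Hamiltonian are given by $\{F_1,F_2\}^G\circ\pi=\{F_1\circ\pi,F_2\circ\pi\}$ and $h=H\circ\pi$. Here $M/G$ is any manifold structure on the orbit space, of dimension $\dim M-\dim G$, for which the projection $\pi:M\to M/G$ is a smooth submersion (it exists when the action is proper). * For all $\eta$ in a residual (comeagre) subset of $\mathfrak g^*$: the reduced system on the symplectic manifold $N_\eta=M_\eta/G_\eta$, where $M_\eta=\Phi^{-1}(\eta)$ is an embedded submanifold of dimension $\dim M-\dim G$, $G_\eta$ is the coadjoint isotropy group of $\eta$, $\pi_\eta:M_\eta\to N_\eta$ is a smooth submersion onto a manifold whose fibres are the $G_\eta$-orbits, $\omega_\eta$ is a symplectic form with $\pi_\eta^*\omega_\eta=\omega|_{M_\eta}$, and the reduced Hamiltonian is given by $h|_{M_\eta}=H_\eta\circ\pi_\eta$. (ii) If the Hamiltonian system of $h$ is $\mathbb T^n$-dense completely integrable,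 then $G$ is commutative. -/

import Mathlib

open scoped Manifold ContDiff

noncomputable section

/-! ### Bivector fields, Poisson brackets and integrability

All manifolds are smooth, without boundary, modelled on a finite-dimensional real vector space `E`.
-/

section Poisson

variable {E : Type*} [NormedAddCommGroup E] [NormedSpace ℝ E]
  {M : Type*} [TopologicalSpace M] [ChartedSpace E M]

/-- The cotangent space `T*_x M`. -/
abbrev Cotangent (E : Type*) [NormedAddCommGroup E] [NormedSpace ℝ E]
    {M : Type*} [TopologicalSpace M] [ChartedSpace E M] (x : M) : Type _ :=
  TangentSpace 𝓘(ℝ, E) x →L[ℝ] ℝ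

/-- A field of bilinear forms on the cotangent spaces: `Λ x α β = Λ_x(α, β)`. -/
abbrev BivectorField (E : Type*) [NormedAddCommGroup E] [NormedSpace ℝ E]
    (M : Type*) [TopologicalSpace M] [ChartedSpace E M] : Type _ :=
  ∀ x : M, LinearMap.BilinForm ℝ (Cotangent E x)

/-- The differential `df_x ∈ T*_x M` of a real function. -/
def differential (f : M → ℝ) (x : M) : Cotangent E x :=
  mvfderiv 𝓘(ℝ, E) f x

/-- The Poisson bracket `{f, g}(x) = Λ_x(df_x, dg_x)`. -/
def poissonBracket (Λ : BivectorField E M) (f g : M → ℝ) (x : M) : ℝ :=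
  Λ x (differential f x) (differential g x)

/-- `f` is a first integral of `ḟ = {f, h}`. -/
def IsFirstIntegral (Λ : BivectorField E M) (h f : M → ℝ) : Prop :=
  ∀ x, poissonBracket Λ f h x = 0

/-- `F_x`, the span of the differentials at `x` of the functions in `F`. -/
def differentialSpan (F : Set C^∞⟮𝓘(ℝ, E), M; ℝ⟯) (x : M) : Submodule ℝ (Cotangent E x) :=
  Submodule.span ℝ {α | ∃ f ∈ F, α = differential f x}

/-- `K_x`, the kernel of the restriction of `Λ_x` to `F_x`. -/
def differentialKernel (Λ : BivectorField E M) (F : Set C^∞⟮𝓘(ℝ, E), M; ℝ⟯) (x : M) :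
    Submodule ℝ (Cotangent E x) :=
  differentialSpan F x ⊓ ⨅ β ∈ differentialSpan F x, LinearMap.ker ((Λ x).flip β)

/-- The corank of `Λ` at `x`. -/
def corank (Λ : BivectorField E M) (x : M) : ℕ :=
  Module.finrank ℝ (LinearMap.ker (Λ x))

/-- `F` is closed under the Poisson bracket. -/
def IsPoissonClosed (Λ : BivectorField E M) (F : Set C^∞⟮𝓘(ℝ, E), M; ℝ⟯) : Prop :=
  ∀ f ∈ F, ∀ g ∈ F, ∃ k ∈ F, ∀ x, k x = poissonBracket Λ f g x

/-- `F` is complete: on an open dense set `dim F_x` and `dim K_x` are constants `l` and `r`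
(the differential dimension and the differential index of `F`), and
`l + r = dim M + corank Λ`. -/
def IsCompleteFamily (Λ : BivectorField E M) (F : Set C^∞⟮𝓘(ℝ, E), M; ℝ⟯) : Prop :=
  ∃ (l r : ℕ) (U : Set M), IsOpen U ∧ Dense U ∧ ∀ x ∈ U,
    Module.finrank ℝ (differentialSpan F x) = l ∧
    Module.finrank ℝ (differentialKernel Λ F x) = r ∧
    l + r = Module.finrank ℝ E + corank Λ x

/-- The system with Hamiltonian `h` is completely integrable in the noncommutative sense by
integrals from the class `A`: it has a complete algebra of integrals, contained in `A`. -/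
def IsNoncommutativelyIntegrable (Λ : BivectorField E M) (h : M → ℝ)
    (A : Set C^∞⟮𝓘(ℝ, E), M; ℝ⟯) : Prop :=
  ∃ F : Subalgebra ℝ C^∞⟮𝓘(ℝ, E), M; ℝ⟯,
    IsPoissonClosed Λ F ∧ IsCompleteFamily Λ F ∧
    ∀ f ∈ F, f ∈ A ∧ IsFirstIntegral Λ h f

/-- `f₁, …, f_N` is a complete involutive set of integrals with respect to the set `U`:
Poisson-commuting integrals whose differentials are linearly independent on the open dense set
`U`, their number being `N = (dim M + corank Λ) / 2` (so `N = n` if `M` is symplectic of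
dimension `2n`). -/
structure IsCompleteInvolutive (Λ : BivectorField E M) (h : M → ℝ) {N : ℕ}
    (f : Fin N → C^∞⟮𝓘(ℝ, E), M; ℝ⟯) (U : Set M) : Prop where
  commute : ∀ i j x, poissonBracket Λ (f i) (f j) x = 0
  integral : ∀ i, IsFirstIntegral Λ h (f i)
  isOpen : IsOpen U
  dense : Dense U
  independent : ∀ x ∈ U, LinearIndependent ℝ fun i => differential (E := E) (f i) x
  card : ∀ x ∈ U, 2 * N = Module.finrank ℝ E + corank Λ x

/-- The system with Hamiltonian `h` is completely integrable (in the sense of Liouville) by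
integrals from the class `A`. -/
def IsLiouvilleIntegrable (Λ : BivectorField E M) (h : M → ℝ)
    (A : Set C^∞⟮𝓘(ℝ, E), M; ℝ⟯) : Prop :=
  ∃ (N : ℕ) (f : Fin N → C^∞⟮𝓘(ℝ, E), M; ℝ⟯) (U : Set M),
    IsCompleteInvolutive Λ h f U ∧ ∀ i, f i ∈ A

end Poisson

/-! ### Symplectic forms -/

section Symplectic

/-- The value `dΩ(X, Y, Z)` of the exterior derivative of a 2-form on vector fields. -/
def extDerivTwoForm {E : Type*} [NormedAddCommGroup E] [NormedSpace ℝ E]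
    {M : Type*} [TopologicalSpace M] [ChartedSpace E M]
    (Ω : ∀ x : M, TangentSpace 𝓘(ℝ, E) x →L[ℝ] TangentSpace 𝓘(ℝ, E) x →L[ℝ] ℝ)
    (X Y Z : ∀ x : M, TangentSpace 𝓘(ℝ, E) x) (x : M) : ℝ :=
  differential (fun y => Ω y (Y y) (Z y)) x (X x)
    + differential (fun y => Ω y (Z y) (X y)) x (Y x)
    + differential (fun y => Ω y (X y) (Y y)) x (Z x)
    - Ω x (VectorField.mlieBracket 𝓘(ℝ, E) X Y x) (Z x)
    - Ω x (VectorField.mlieBracket 𝓘(ℝ, E) Y Z x) (X x)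
    - Ω x (VectorField.mlieBracket 𝓘(ℝ, E) Z X x) (Y x)

/-- A symplectic form: a smooth, closed, nondegenerate 2-form. -/
structure SymplecticForm (E : Type*) [NormedAddCommGroup E] [NormedSpace ℝ E]
    (M : Type*) [TopologicalSpace M] [ChartedSpace E M] [IsManifold 𝓘(ℝ, E) ∞ M] where
  /-- the bilinear form `Ω_x` on `T_x M` -/
  form : ∀ x : M, TangentSpace 𝓘(ℝ, E) x →L[ℝ] TangentSpace 𝓘(ℝ, E) x →L[ℝ] ℝ
  contMDiff : ContMDiff 𝓘(ℝ, E) (𝓘(ℝ, E).prod 𝓘(ℝ, E →L[ℝ] E →L[ℝ] ℝ)) ∞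
    (fun x => Bundle.TotalSpace.mk' (E →L[ℝ] E →L[ℝ] ℝ)
      (E := fun x : M => TangentSpace 𝓘(ℝ, E) x →L[ℝ] TangentSpace 𝓘(ℝ, E) x →L[ℝ] ℝ)
      x (form x))
  alternating : ∀ x v, form x v v = 0
  nondegenerate : ∀ x, Function.Bijective (form x)
  closed : ∀ X Y Z : ∀ x : M, TangentSpace 𝓘(ℝ, E) x,
    ContMDiff 𝓘(ℝ, E) 𝓘(ℝ, E).tangent ∞ (fun x => (⟨x, X x⟩ : TangentBundle 𝓘(ℝ, E) M)) →
    ContMDiff 𝓘(ℝ, E) 𝓘(ℝ, E).tangent ∞ (fun x => (⟨x, Y x⟩ : TangentBundle 𝓘(ℝ, E) M)) →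
    ContMDiff 𝓘(ℝ, E) 𝓘(ℝ, E).tangent ∞ (fun x => (⟨x, Z x⟩ : TangentBundle 𝓘(ℝ, E) M)) →
    ∀ x, extDerivTwoForm form X Y Z x = 0

variable {E : Type*} [NormedAddCommGroup E] [NormedSpace ℝ E]
  {M : Type*} [TopologicalSpace M] [ChartedSpace E M] [IsManifold 𝓘(ℝ, E) ∞ M]

/-- The isomorphism `T_x M ≃ T*_x M`, `v ↦ Ω_x(v, ·)`. -/
def SymplecticForm.flat (Ω : SymplecticForm E M) (x : M) :
    TangentSpace 𝓘(ℝ, E) x ≃ₗ[ℝ] Cotangent E x :=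
  LinearEquiv.ofBijective (Ω.form x : TangentSpace 𝓘(ℝ, E) x →ₗ[ℝ] Cotangent E x)
    (Ω.nondegenerate x)

/-- The vector `X_α` with `α = Ω_x(·, X_α)`. -/
def SymplecticForm.sharp (Ω : SymplecticForm E M) (x : M) :
    Cotangent E x →ₗ[ℝ] TangentSpace 𝓘(ℝ, E) x :=
  -((Ω.flat x).symm : Cotangent E x →ₗ[ℝ] TangentSpace 𝓘(ℝ, E) x)

/-- The Hamiltonian vector field `X_f`, determined by `df_x(v) = Ω_x(v, X_f(x))`. -/
def SymplecticForm.hamiltonianField (Ω : SymplecticForm E M) (f : M → ℝ) (x : M) :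
    TangentSpace 𝓘(ℝ, E) x :=
  Ω.sharp x (differential f x)

/-- The bivector field of the canonical Poisson bracket, `Λ_x(α, β) = α(X_β)`. -/
def SymplecticForm.bivector (Ω : SymplecticForm E M) : BivectorField E M := fun x =>
  LinearMap.mk₂ ℝ (fun α β : Cotangent E x => α (Ω.sharp x β))
    (fun _ _ _ => rfl) (fun _ _ _ => rfl) (fun _ _ _ => by simp) (fun _ _ _ => by simp)

theorem SymplecticForm.form_swap (Ω : SymplecticForm E M) (x : M)
    (v w : TangentSpace 𝓘(ℝ, E) x) : Ω.form x v w = -Ω.form x w v := by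
  have h := Ω.alternating x (v + w)
  simp only [map_add, add_apply, Ω.alternating] at h
  linarith

theorem SymplecticForm.form_hamiltonianField (Ω : SymplecticForm E M) (f : M → ℝ) (x : M)
    (v : TangentSpace 𝓘(ℝ, E) x) :
    Ω.form x v (Ω.hamiltonianField f x) = differential f x v := by
  have h : Ω.form x ((Ω.flat x).symm (differential f x)) = differential f x :=
    (Ω.flat x).apply_symm_apply (differential f x)
  rw [Ω.form_swap, hamiltonianField, sharp]
  simp [h]

theorem SymplecticForm.poissonBracket_eq (Ω : SymplecticForm E M) (f g : M → ℝ) (x : M) :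
    poissonBracket Ω.bivector f g x =
      Ω.form x (Ω.hamiltonianField g x) (Ω.hamiltonianField f x) := by
  rw [form_hamiltonianField]
  rfl

end Symplectic

/-! ### Hamiltonian actions and reduction -/

section Actions

variable {EG : Type*} [NormedAddCommGroup EG] [NormedSpace ℝ EG]
  {G : Type*} [TopologicalSpace G] [ChartedSpace EG G] [Group G]
  {E : Type*} [NormedAddCommGroup E] [NormedSpace ℝ E]
  {M : Type*} [TopologicalSpace M] [ChartedSpace E M] [IsManifold 𝓘(ℝ, E) ∞ M]
  [MulAction G M]

/-- The dual `𝔤*` of the Lie algebra `𝔤` of `G`. -/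
abbrev LieDual (EG : Type*) [NormedAddCommGroup EG] [NormedSpace ℝ EG]
    (G : Type*) [TopologicalSpace G] [ChartedSpace EG G] [Group G] : Type _ :=
  GroupLieAlgebra 𝓘(ℝ, EG) G →L[ℝ] ℝ

/-- The action of `G` on `(M, Ω)` is Hamiltonian with moment map `Φ`. -/
structure IsHamiltonianAction (Ω : SymplecticForm E M) (Φ : M → LieDual EG G) : Prop where
  /-- `G` acts by symplectomorphisms. -/
  symplectic : ∀ (g : G) (x : M) (u v : TangentSpace 𝓘(ℝ, E) x),
    Ω.form (g • x) (mfderiv 𝓘(ℝ, E) 𝓘(ℝ, E) (fun y : M => g • y) x u)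
      (mfderiv 𝓘(ℝ, E) 𝓘(ℝ, E) (fun y : M => g • y) x v) = Ω.form x u v
  /-- The functions `φ_ξ = (Φ(·), ξ)` are smooth. -/
  smooth : ∀ ξ, ContMDiff 𝓘(ℝ, E) 𝓘(ℝ, ℝ) ∞ (fun x => Φ x ξ)
  /-- The infinitesimal generator of the one-parameter subgroup of `ξ` is `X_{φ_ξ}`. -/
  generator : ∀ (ξ : GroupLieAlgebra 𝓘(ℝ, EG) G) (x : M),
    (mfderiv 𝓘(ℝ, EG) 𝓘(ℝ, E) (fun g : G => g • x) 1 ξ : E) =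
      Ω.hamiltonianField (fun y => Φ y ξ) x
  /-- `φ_[ξ₁, ξ₂] = {φ_ξ₁, φ_ξ₂}`. -/
  bracket : ∀ (ξ₁ ξ₂ : GroupLieAlgebra 𝓘(ℝ, EG) G) (x : M),
    Φ x ⁅ξ₁, ξ₂⁆ = poissonBracket Ω.bivector (fun y => Φ y ξ₁) (fun y => Φ y ξ₂) x

/-- The smooth `G`-invariant functions. -/
def invariantFunctions (G : Type*) [Group G]
    (E : Type*) [NormedAddCommGroup E] [NormedSpace ℝ E]
    (M : Type*) [TopologicalSpace M] [ChartedSpace E M] [MulAction G M] :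
    Set C^∞⟮𝓘(ℝ, E), M; ℝ⟯ :=
  {f | ∀ (g : G) (x : M), f (g • x) = f x}

/-- The adjoint representation of `G` on `𝔤`: the derivative at `1` of conjugation by `g`. -/
def adjointRep (g : G) : GroupLieAlgebra 𝓘(ℝ, EG) G → GroupLieAlgebra 𝓘(ℝ, EG) G := fun ξ =>
  (mfderiv 𝓘(ℝ, EG) 𝓘(ℝ, EG) (fun a : G => g * a * g⁻¹) 1 ξ : EG)

/-- The isotropy group `G_η` of `η ∈ 𝔤*` under the coadjoint action. -/
def coadjointStabilizer (η : LieDual EG G) : Set G :=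
  {g | ∀ ξ : GroupLieAlgebra 𝓘(ℝ, EG) G, η (adjointRep g ξ) = η ξ}

/-- `p : M → B` presents the manifold `B` as the quotient manifold `M / G` of a free action:
`p` is a surjective smooth submersion onto a manifold of dimension `dim M - dim G`, and its
fibres are the `G`-orbits. -/
structure IsOrbitManifold (EG : Type*) [NormedAddCommGroup EG] [NormedSpace ℝ EG]
    (G : Type*) [Group G] [MulAction G M]
    {EB : Type*} [NormedAddCommGroup EB] [NormedSpace ℝ EB]
    {B : Type*} [TopologicalSpace B] [ChartedSpace EB B] (p : M → B) : Prop where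
  contMDiff : ContMDiff 𝓘(ℝ, E) 𝓘(ℝ, EB) ∞ p
  surjective : Function.Surjective p
  submersion : ∀ x, Function.Surjective (mfderiv 𝓘(ℝ, E) 𝓘(ℝ, EB) p x)
  finrank_add : Module.finrank ℝ EB + Module.finrank ℝ EG = Module.finrank ℝ E
  fibre : ∀ x y, p x = p y ↔ ∃ g : G, g • x = y

/-- `ΛB` is the Poisson structure induced by `Ω` on the quotient `p : M → B`:
`{F₁, F₂}^G ∘ p = {F₁ ∘ p, F₂ ∘ p}`. -/
def IsReducedPoisson (Ω : SymplecticForm E M)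
    {EB : Type*} [NormedAddCommGroup EB] [NormedSpace ℝ EB]
    {B : Type*} [TopologicalSpace B] [ChartedSpace EB B] (p : M → B)
    (ΛB : BivectorField EB B) : Prop :=
  ∀ F₁ F₂ : C^∞⟮𝓘(ℝ, EB), B; ℝ⟯, ∀ x : M,
    poissonBracket ΛB F₁ F₂ (p x) = poissonBracket Ω.bivector (F₁ ∘ p) (F₂ ∘ p) x

/-- `ι : S → M` presents the manifold `S` as the submanifold `M_η = Φ⁻¹(η)` over a regular value
`η` of `Φ`: `ι` is a smooth embedding with image `Φ⁻¹(η)`, of codimension `dim 𝔤*`. -/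
structure IsMomentLevel (Φ : M → LieDual EG G) (η : LieDual EG G)
    {ES : Type*} [NormedAddCommGroup ES] [NormedSpace ℝ ES]
    {S : Type*} [TopologicalSpace S] [ChartedSpace ES S] (ι : S → M) : Prop where
  contMDiff : ContMDiff 𝓘(ℝ, ES) 𝓘(ℝ, E) ∞ ι
  immersion : ∀ s, Function.Injective (mfderiv 𝓘(ℝ, ES) 𝓘(ℝ, E) ι s)
  isEmbedding : Topology.IsEmbedding ι
  range_eq : Set.range ι = {x | Φ x = η}
  finrank_add : Module.finrank ℝ ES + Module.finrank ℝ EG = Module.finrank ℝ E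

/-- `π : S → N` and `ΩN` present `N` as the reduced symplectic manifold `N_η = M_η / G_η`, where
`ι : S → M` is the submanifold `M_η`: `π` is a surjective smooth submersion whose fibres are the
`G_η`-orbits, and the restriction of `Ω` to `M_η` is the pullback of `ΩN`. -/
structure IsReducedSpace (Ω : SymplecticForm E M) (η : LieDual EG G)
    {ES : Type*} [NormedAddCommGroup ES] [NormedSpace ℝ ES]
    {S : Type*} [TopologicalSpace S] [ChartedSpace ES S] (ι : S → M)
    {EN : Type*} [NormedAddCommGroup EN] [NormedSpace ℝ EN]
    {N : Type*} [TopologicalSpace N] [ChartedSpace EN N] [IsManifold 𝓘(ℝ, EN) ∞ N]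
    (π : S → N) (ΩN : SymplecticForm EN N) : Prop where
  contMDiff : ContMDiff 𝓘(ℝ, ES) 𝓘(ℝ, EN) ∞ π
  surjective : Function.Surjective π
  submersion : ∀ s, Function.Surjective (mfderiv 𝓘(ℝ, ES) 𝓘(ℝ, EN) π s)
  fibre : ∀ s t, π s = π t ↔ ∃ g ∈ coadjointStabilizer η, g • ι s = ι t
  pullback : ∀ (s : S) (u v : TangentSpace 𝓘(ℝ, ES) s),
    ΩN.form (π s) (mfderiv 𝓘(ℝ, ES) 𝓘(ℝ, EN) π s u) (mfderiv 𝓘(ℝ, ES) 𝓘(ℝ, EN) π s v) =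
      Ω.form (ι s) (mfderiv 𝓘(ℝ, ES) 𝓘(ℝ, E) ι s u) (mfderiv 𝓘(ℝ, ES) 𝓘(ℝ, E) ι s v)

end Actions

/-! ### Toroidal domains -/

section Toroidal

variable {E : Type*} [NormedAddCommGroup E] [NormedSpace ℝ E]
  {M : Type*} [TopologicalSpace M] [ChartedSpace E M] [IsManifold 𝓘(ℝ, E) ∞ M]

/-- The coordinate space `ℝⁿ{φ} × ℝⁿ{I}` of angle and action variables. -/
abbrev AngleAction (n : ℕ) : Type := EuclideanSpace ℝ (Fin n) × EuclideanSpace ℝ (Fin n)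

/-- The set `ℝⁿ × B_σ`, which covers the toroidal domain `𝕋ⁿ × B_σ`. -/
def toroidalCover (n : ℕ) (σ : ℝ) : Set (AngleAction n) := {z | z.2 ∈ Metric.ball 0 σ}

/-- `ψ(φ, I)` is a system of action-angle variables `I`, `φ mod 2π`, which identifies the toroidal
domain `𝕋ⁿ{φ} × B_σ{I}` with an open set of `M`: there `Ω = ∑ dI_i ∧ dφ_i` and `h = H(I)`. -/
structure IsActionAngle (Ω : SymplecticForm E M) (h : M → ℝ) {n : ℕ} (σ : ℝ)
    (ψ : AngleAction n → M) (H : EuclideanSpace ℝ (Fin n) → ℝ) : Prop where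
  pos : 0 < σ
  contMDiffOn : ContMDiffOn 𝓘(ℝ, AngleAction n) 𝓘(ℝ, E) ∞ ψ (toroidalCover n σ)
  isOpen_image : IsOpen (ψ '' toroidalCover n σ)
  eq_iff : ∀ z ∈ toroidalCover n σ, ∀ w ∈ toroidalCover n σ,
    (ψ z = ψ w ↔ z.2 = w.2 ∧ ∃ k : Fin n → ℤ, ∀ i, w.1 i = z.1 i + 2 * Real.pi * k i)
  canonical : ∀ z ∈ toroidalCover n σ, ∀ u v : AngleAction n,
    Ω.form (ψ z) (mfderiv 𝓘(ℝ, AngleAction n) 𝓘(ℝ, E) ψ z u)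
      (mfderiv 𝓘(ℝ, AngleAction n) 𝓘(ℝ, E) ψ z v) =
      ∑ i, (u.2 i * v.1 i - v.2 i * u.1 i)
  hamiltonian : ∀ z ∈ toroidalCover n σ, h (ψ z) = H z.2

/-- The frequencies `ν_i(I) = ∂H/∂I_i`. -/
def frequency {n : ℕ} (H : EuclideanSpace ℝ (Fin n) → ℝ) (I : EuclideanSpace ℝ (Fin n))
    (i : Fin n) : ℝ :=
  fderiv ℝ H I (EuclideanSpace.single i 1)

/-- The system `φ̇_i = ∂H/∂I_i`, `İ = 0` on `𝕋ⁿ × B_σ` is `𝕋ⁿ`-dense: for a dense set of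
`I₀ ∈ B_σ` its trajectories on the torus `I = I₀` are dense in that torus. -/
def IsTorusDense {n : ℕ} (σ : ℝ) (H : EuclideanSpace ℝ (Fin n) → ℝ) : Prop :=
  Metric.ball 0 σ ⊆ closure {I₀ ∈ Metric.ball 0 σ | ∀ φ₀ : Fin n → ℝ,
    Dense (Set.range fun (t : ℝ) (i : Fin n) =>
      ((φ₀ i + t * frequency H I₀ i : ℝ) : AddCircle (2 * Real.pi)))}

/-- The system with Hamiltonian `h` is `𝕋ⁿ`-dense completely integrable: it has a complete
involutive set of integrals `f₁, …, f_n`, and its regular set `U` is covered by toroidal domains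
in which the system is `𝕋ⁿ`-dense. -/
def IsTorusDenseIntegrable (Ω : SymplecticForm E M) (h : M → ℝ) (n : ℕ) : Prop :=
  ∃ (f : Fin n → C^∞⟮𝓘(ℝ, E), M; ℝ⟯) (U : Set M), IsCompleteInvolutive Ω.bivector h f U ∧
    ∀ x ∈ U, ∃ (σ : ℝ) (ψ : AngleAction n → M) (H : EuclideanSpace ℝ (Fin n) → ℝ),
      IsActionAngle Ω h σ ψ H ∧ x ∈ ψ '' toroidalCover n σ ∧ IsTorusDense σ H

end Toroidal

end

/-! Fix a point `x` and let `P` be the span of the covectors `dφ_ξ` (`momentSpan`). An invariant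
function is constant along the generators `X_{φ_ξ}`, so the span `F` of the differentials of
invariant functions lies in the `Λ`-orthogonal of `P`; equivalently `P ≤ F^⊥`. Completeness says
`dim F + dim (F ∩ F^⊥) = dim M`, which forces `F^⊥ ≤ F`. Hence `P ≤ F ∩ F^⊥`, and the `φ_ξ` commute
on a dense set (`momentSpan_le_differentialKernel`). Since `{φ_ξ, φ_ζ}` is itself the continuous
function `φ_[ξ,ζ]`, they commute everywhere.

Commuting moments give a commutative group (`mul_comm_of_moment_commute`). The moment map is then
constant on orbits, so each `g` preserves every generator field, and `c ↦ c⁻¹ g c x` has zero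
derivative. As `G` is connected, this map is constant, and effectiveness gives `c⁻¹ g c = g`.

For a free action both quotients are treated by one scheme, `IsReduction`: functions on `M` are
restricted along `ι : S → M` and descend along a submersion `π : S → N`. For `M / G` the map `ι` is
the identity; the restriction of `Λ` to `P^⊥` has kernel `P`, so the corank of the quotient grows by
exactly the dimension lost. For `M_η / G_η` the restriction kills exactly `P`, which lies in the
kernel of the family, so both `l` and `r` drop by `dim G`, while the dimension drops by `2 dim G`.
The set `U` of good points must remain dense in `M_η`. This holds for generic `η` because freeness
makes `Φ` a submersion, hence an open map (`eventually_residual_dense_fibre`). In the Liouville case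
the restricted integrals become dependent, and generic constant linear combinations of them supply
the right number of independent ones (`exists_combination_dense_linearIndependent`).

For (ii), a first integral of a torus-dense system is constant on almost-periodic tori with dense
trajectories, hence by continuity on all tori; it depends on the actions only. Two such integrals
commute, and by Noether's theorem the `φ_ξ` are first integrals. -/

noncomputable section

/-! ### Submersions, vanishing derivatives and differentials on manifolds -/

section SmoothMaps

open Filter Topology Set

/-- The inverse function theorem applies to `f` restricted to the affine slice `v ↦ a + R v`, where
`R` is a right inverse of the derivative, because the restriction has the identity as its
derivative. -/
theorem ContDiffAt.exists_localSection
    {E : Type*} [NormedAddCommGroup E] [NormedSpace ℝ E] [FiniteDimensional ℝ E]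
    {F : Type*} [NormedAddCommGroup F] [NormedSpace ℝ F] [FiniteDimensional ℝ F]
    {f : E → F} {a : E} (hf : ContDiffAt ℝ ∞ f a)
    (hs : Function.Surjective (fderiv ℝ f a)) :
    ∃ σ : F → E, ContDiffAt ℝ ∞ σ (f a) ∧ σ (f a) = a ∧ ∀ᶠ y in 𝓝 (f a), f (σ y) = y := by
  have : CompleteSpace F := FiniteDimensional.complete ℝ F
  obtain ⟨R, hR⟩ := (fderiv ℝ f a : E →ₗ[ℝ] F).exists_rightInverse_of_surjective
    (LinearMap.range_eq_top.2 hs)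
  let R' : F →L[ℝ] E := LinearMap.toContinuousLinearMap R
  have hR' : ∀ v, fderiv ℝ f a (R' v) = v := fun v => LinearMap.congr_fun hR v
  let l : F → E := fun v => a + R' v
  have hl0 : l 0 = a := by simp [l]
  have hl : ContDiff ℝ ∞ l := contDiff_const.add R'.contDiff
  have hf' : ContDiffAt ℝ ∞ f (l 0) := by rwa [hl0]
  have hg : ContDiffAt ℝ ∞ (f ∘ l) 0 := hf'.comp 0 hl.contDiffAt
  have hl' : HasFDerivAt l R' 0 := R'.hasFDerivAt.const_add a
  have hd : HasFDerivAt (f ∘ l) ((ContinuousLinearEquiv.refl ℝ F : F ≃L[ℝ] F) : F →L[ℝ] F) 0 := by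
    have h1 : HasFDerivAt f (fderiv ℝ f a) (l 0) := by
      rw [hl0]
      exact (hf.differentiableAt (by simp)).hasFDerivAt
    convert! h1.comp (0 : F) hl' using 1
    ext v
    exact (hR' v).symm
  have hn : (∞ : ℕ∞ω) ≠ 0 := by simp
  let τ := hg.localInverse hd hn
  have e0 : (f ∘ l) 0 = f a := by simp [hl0]
  refine ⟨l ∘ τ, ?_, ?_, ?_⟩
  · rw [← e0]
    exact hl.contDiffAt.comp _ (hg.to_localInverse hd hn)
  · have : τ ((f ∘ l) 0) = 0 := (hg.hasStrictFDerivAt' hd hn).localInverse_apply_image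
    rw [← e0, Function.comp_apply, this, hl0]
  · rw [← e0]
    exact (hg.hasStrictFDerivAt' hd hn).eventually_right_inverse

variable {ES : Type*} [NormedAddCommGroup ES] [NormedSpace ℝ ES]
  {S : Type*} [TopologicalSpace S] [ChartedSpace ES S]
  {EN : Type*} [NormedAddCommGroup EN] [NormedSpace ℝ EN]
  {N : Type*} [TopologicalSpace N] [ChartedSpace EN N]

theorem exists_localSection [FiniteDimensional ℝ ES] [FiniteDimensional ℝ EN]
    [IsManifold 𝓘(ℝ, ES) ∞ S] [IsManifold 𝓘(ℝ, EN) ∞ N] {f : S → N} {s : S}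
    (hf : ContMDiffAt 𝓘(ℝ, ES) 𝓘(ℝ, EN) ∞ f s)
    (hs : Function.Surjective (mfderiv 𝓘(ℝ, ES) 𝓘(ℝ, EN) f s)) :
    ∃ σ : N → S, ContMDiffAt 𝓘(ℝ, EN) 𝓘(ℝ, ES) ∞ σ (f s) ∧ σ (f s) = s ∧
      ∀ᶠ y in 𝓝 (f s), f (σ y) = y := by
  have hm : mfderiv 𝓘(ℝ, ES) 𝓘(ℝ, EN) f s =
      fderiv ℝ (writtenInExtChartAt 𝓘(ℝ, ES) 𝓘(ℝ, EN) s f) (extChartAt 𝓘(ℝ, ES) s s) := by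
    rw [(hf.mdifferentiableAt (by simp)).mfderiv]
    simp
    rfl
  rw [hm] at hs
  have hc : ContDiffAt ℝ ∞ (writtenInExtChartAt 𝓘(ℝ, ES) 𝓘(ℝ, EN) s f)
      (extChartAt 𝓘(ℝ, ES) s s) := by
    have := (contMDiffAt_iff.1 hf).2
    simpa [contDiffWithinAt_univ] using this
  obtain ⟨τ, hτ, hτ0, hτ1⟩ := hc.exists_localSection hs
  have e : writtenInExtChartAt 𝓘(ℝ, ES) 𝓘(ℝ, EN) s f (extChartAt 𝓘(ℝ, ES) s s) =
      extChartAt 𝓘(ℝ, EN) (f s) (f s) := by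
    simp [writtenInExtChartAt]
  rw [e] at hτ hτ0 hτ1
  have hσ : ContMDiffAt 𝓘(ℝ, EN) 𝓘(ℝ, ES) ∞
      ((extChartAt 𝓘(ℝ, ES) s).symm ∘ τ ∘ extChartAt 𝓘(ℝ, EN) (f s)) (f s) := by
    have h1 : ContMDiffAt 𝓘(ℝ, ES) 𝓘(ℝ, ES) ∞ (extChartAt 𝓘(ℝ, ES) s).symm
        (τ (extChartAt 𝓘(ℝ, EN) (f s) (f s))) := by
      rw [hτ0]
      exact (contMDiffOn_extChartAt_symm s).contMDiffAt (extChartAt_target_mem_nhds s)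
    exact h1.comp (f s) (hτ.contMDiffAt.comp (f s) contMDiffAt_extChartAt)
  have hσ0 : ((extChartAt 𝓘(ℝ, ES) s).symm ∘ τ ∘ extChartAt 𝓘(ℝ, EN) (f s)) (f s) = s := by
    simp only [Function.comp_apply, hτ0]
    exact extChartAt_to_inv s
  refine ⟨_, hσ, hσ0, ?_⟩
  have h2 := (continuousAt_extChartAt (I := 𝓘(ℝ, EN)) (f s)).eventually hτ1
  have h3 : ∀ᶠ y in 𝓝 (f s), y ∈ (extChartAt 𝓘(ℝ, EN) (f s)).source :=
    extChartAt_source_mem_nhds (f s)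
  -- The identity `f (σ y) = y` is known only in the chart at `f s`; injectivity of the chart
  -- applies once both sides lie in its source.
  have h4 : ∀ᶠ y in 𝓝 (f s), f (((extChartAt 𝓘(ℝ, ES) s).symm ∘ τ ∘
      extChartAt 𝓘(ℝ, EN) (f s)) y) ∈ (extChartAt 𝓘(ℝ, EN) (f s)).source := by
    have hcont : ContinuousAt (f ∘ ((extChartAt 𝓘(ℝ, ES) s).symm ∘ τ ∘
        extChartAt 𝓘(ℝ, EN) (f s))) (f s) := by
      refine ContinuousAt.comp ?_ hσ.continuousAt
      rw [hσ0]
      exact hf.continuousAt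
    refine hcont.eventually_mem ?_
    rw [Function.comp_apply, hσ0]
    exact extChartAt_source_mem_nhds (f s)
  filter_upwards [h2, h3, h4] with y hy1 hy2 hy3
  exact (extChartAt 𝓘(ℝ, EN) (f s)).injOn hy3 hy2 hy1

theorem isOpenMap_of_surjective_mfderiv [FiniteDimensional ℝ ES] [FiniteDimensional ℝ EN]
    [IsManifold 𝓘(ℝ, ES) ∞ S] [IsManifold 𝓘(ℝ, EN) ∞ N] {f : S → N}
    (hf : ContMDiff 𝓘(ℝ, ES) 𝓘(ℝ, EN) ∞ f)
    (hs : ∀ s, Function.Surjective (mfderiv 𝓘(ℝ, ES) 𝓘(ℝ, EN) f s)) : IsOpenMap f := by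
  refine IsOpenMap.of_nhds_le fun s U hU => ?_
  obtain ⟨σ, hσ, hσ0, hσ1⟩ := exists_localSection (hf s) (hs s)
  have h1 : ∀ᶠ y in 𝓝 (f s), σ y ∈ f ⁻¹' U := by
    refine hσ.continuousAt.eventually_mem ?_
    rwa [hσ0]
  filter_upwards [h1, hσ1] with y hy1 hy2
  rwa [mem_preimage, hy2] at hy1

/-- A smooth function that is constant on the fibres of a surjective submersion descends. -/
theorem exists_contMDiffMap_comp_eq [FiniteDimensional ℝ ES] [FiniteDimensional ℝ EN]
    [IsManifold 𝓘(ℝ, ES) ∞ S] [IsManifold 𝓘(ℝ, EN) ∞ N] {p : S → N}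
    (hp : ContMDiff 𝓘(ℝ, ES) 𝓘(ℝ, EN) ∞ p) (hsurj : Function.Surjective p)
    (hs : ∀ s, Function.Surjective (mfderiv 𝓘(ℝ, ES) 𝓘(ℝ, EN) p s))
    {f : S → ℝ} (hf : ContMDiff 𝓘(ℝ, ES) 𝓘(ℝ, ℝ) ∞ f) (hc : ∀ s t, p s = p t → f s = f t) :
    ∃ F : C^∞⟮𝓘(ℝ, EN), N; ℝ⟯, ∀ s, F (p s) = f s := by
  have hF : ∀ s, (f ∘ Function.surjInv hsurj) (p s) = f s := fun s =>
    hc _ _ (Function.surjInv_eq hsurj (p s))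
  -- The chosen preimages need not vary continuously; smoothness comes from the equality with `f ∘
  -- σ` for a smooth local section `σ`.
  refine ⟨⟨f ∘ Function.surjInv hsurj, fun y => ?_⟩, hF⟩
  obtain ⟨s, rfl⟩ := hsurj y
  obtain ⟨σ, hσ, hσ0, hσ1⟩ := exists_localSection (hp s) (hs s)
  have h1 : ContMDiffAt 𝓘(ℝ, EN) 𝓘(ℝ, ℝ) ∞ (f ∘ σ) (p s) := (hf _).comp _ hσ
  refine h1.congr_of_eventuallyEq ?_
  filter_upwards [hσ1] with y hy
  rw [Function.comp_apply (f := f) (g := σ), ← hF (σ y), hy]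

/-- A map whose derivative vanishes near a point is constant near this point. -/
theorem eventually_eq_of_mfderiv_eq_zero [IsManifold 𝓘(ℝ, ES) 1 S] [IsManifold 𝓘(ℝ, EN) 1 N]
    {f : S → N} {s : S} (hf : ∀ᶠ t in 𝓝 s, MDifferentiableAt 𝓘(ℝ, ES) 𝓘(ℝ, EN) f t)
    (h0 : ∀ᶠ t in 𝓝 s, ∀ v, (mfderiv 𝓘(ℝ, ES) 𝓘(ℝ, EN) f t v : EN) = 0) :
    ∀ᶠ t in 𝓝 s, f t = f s := by
  set φ := extChartAt 𝓘(ℝ, ES) s with hφ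
  set ψ := extChartAt 𝓘(ℝ, EN) (f s) with hψ
  have hpre : f ⁻¹' ψ.source ∈ 𝓝 s :=
    hf.self_of_nhds.continuousAt.preimage_mem_nhds (extChartAt_source_mem_nhds (f s))
  have hnhds : φ.target ∩ φ.symm ⁻¹' (f ⁻¹' ψ.source ∩
      {t | MDifferentiableAt 𝓘(ℝ, ES) 𝓘(ℝ, EN) f t ∧
        ∀ v, (mfderiv 𝓘(ℝ, ES) 𝓘(ℝ, EN) f t v : EN) = 0}) ∈ 𝓝 (φ s) := by
    refine inter_mem (extChartAt_target_mem_nhds s) ?_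
    refine (continuousAt_extChartAt_symm s).preimage_mem_nhds ?_
    rw [extChartAt_to_inv s]
    exact inter_mem hpre (hf.and h0)
  obtain ⟨ε, hε, hball⟩ := Metric.mem_nhds_iff.1 hnhds
  have hderiv : ∀ z ∈ Metric.ball (φ s) ε, HasFDerivAt (ψ ∘ f ∘ φ.symm) (0 : ES →L[ℝ] EN) z := by
    intro z hz
    have h1 : MDifferentiableAt 𝓘(ℝ, ES) 𝓘(ℝ, ES) φ.symm z :=
      ((contMDiffOn_extChartAt_symm (n := 1) s).contMDiffAt
        (extChartAt_target_mem_nhds' (hball hz).1)).mdifferentiableAt (by simp)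
    have h2 : MDifferentiableAt 𝓘(ℝ, EN) 𝓘(ℝ, EN) ψ (f (φ.symm z)) :=
      (contMDiffAt_extChartAt' (n := 1) (by simpa [hψ] using (hball hz).2.1)).mdifferentiableAt
        (by simp)
    have h3 := h2.hasMFDerivAt.comp z ((hball hz).2.2.1.hasMFDerivAt.comp z h1.hasMFDerivAt)
    have h5 : (mfderiv 𝓘(ℝ, EN) 𝓘(ℝ, EN) ψ (f (φ.symm z))).comp
        ((mfderiv 𝓘(ℝ, ES) 𝓘(ℝ, EN) f (φ.symm z)).comp
          (mfderiv 𝓘(ℝ, ES) 𝓘(ℝ, ES) φ.symm z)) = 0 := by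
      ext v
      have := (hball hz).2.2.2 (mfderiv 𝓘(ℝ, ES) 𝓘(ℝ, ES) φ.symm z v)
      change mfderiv 𝓘(ℝ, EN) 𝓘(ℝ, EN) ψ (f (φ.symm z)) (mfderiv 𝓘(ℝ, ES) 𝓘(ℝ, EN) f (φ.symm z)
        (mfderiv 𝓘(ℝ, ES) 𝓘(ℝ, ES) φ.symm z v)) = 0
      exact (congrArg _ this).trans (map_zero _)
    rw [h5] at h3
    exact h3.hasFDerivAt
  have hconst : ∀ z ∈ Metric.ball (φ s) ε, (ψ ∘ f ∘ φ.symm) z = (ψ ∘ f ∘ φ.symm) (φ s) :=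
    fun z hz => (convex_ball (φ s) ε).is_const_of_fderivWithin_eq_zero (𝕜 := ℝ)
      (fun w hw => (hderiv w hw).differentiableAt.differentiableWithinAt)
      (fun w hw => by
        rw [fderivWithin_of_isOpen Metric.isOpen_ball hw, (hderiv w hw).fderiv])
      hz (Metric.mem_ball_self hε)
  have h5 : ∀ᶠ t in 𝓝 s, φ t ∈ Metric.ball (φ s) ε :=
    (continuousAt_extChartAt s).eventually_mem (Metric.ball_mem_nhds _ hε)
  filter_upwards [h5, hpre, extChartAt_source_mem_nhds (I := 𝓘(ℝ, ES)) s] with t ht1 ht2 ht3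
  have h6 := hconst _ ht1
  simp only [Function.comp_apply, φ.left_inv ht3, φ.left_inv (mem_extChartAt_source s)] at h6
  exact ψ.injOn ht2 (mem_extChartAt_source (f s)) h6

/-- A map with vanishing derivative on a connected manifold is constant. -/
theorem eq_of_mfderiv_eq_zero [IsManifold 𝓘(ℝ, ES) 1 S] [IsManifold 𝓘(ℝ, EN) 1 N]
    [PreconnectedSpace S] {f : S → N}
    (hf : MDifferentiable 𝓘(ℝ, ES) 𝓘(ℝ, EN) f)
    (h0 : ∀ s v, (mfderiv 𝓘(ℝ, ES) 𝓘(ℝ, EN) f s v : EN) = 0) (s t : S) : f s = f t :=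
  IsLocallyConstant.apply_eq_of_preconnectedSpace
    ((IsLocallyConstant.iff_eventually_eq f).2 fun _ => eventually_eq_of_mfderiv_eq_zero
      (Eventually.of_forall hf) (Eventually.of_forall h0)) s t

/-- Every covector is the differential of a smooth function. -/
theorem exists_differential_eq [FiniteDimensional ℝ EN] [T2Space N] [IsManifold 𝓘(ℝ, EN) ∞ N]
    (y : N) (α : Cotangent EN y) : ∃ F : C^∞⟮𝓘(ℝ, EN), N; ℝ⟯, differential F y = α := by
  let b : SmoothBumpFunction 𝓘(ℝ, EN) y := Classical.arbitrary _
  let A : EN →L[ℝ] ℝ := α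
  have hg : ContMDiffOn 𝓘(ℝ, EN) 𝓘(ℝ, ℝ) ∞ (fun x => A (extChartAt 𝓘(ℝ, EN) y x))
      (chartAt EN y).source :=
    A.contMDiff.comp_contMDiffOn contMDiffOn_extChartAt
  refine ⟨⟨_, b.contMDiff_smul hg⟩, ?_⟩
  have h1 : (fun x => b x • A (extChartAt 𝓘(ℝ, EN) y x)) =ᶠ[𝓝 y]
      fun x => A (extChartAt 𝓘(ℝ, EN) y x) := by
    filter_upwards [b.eventuallyEq_one] with x hx
    simp [hx]
  have h2 : HasMFDerivAt 𝓘(ℝ, EN) 𝓘(ℝ, ℝ) (fun x => A (extChartAt 𝓘(ℝ, EN) y x)) y α := by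
    refine ⟨A.continuous.continuousAt.comp (continuousAt_extChartAt y), ?_⟩
    have h3 : HasFDerivAt (A : EN → ℝ) A (extChartAt 𝓘(ℝ, EN) y y) := A.hasFDerivAt
    refine (h3.congr_of_eventuallyEq ?_).hasFDerivWithinAt
    filter_upwards [extChartAt_target_mem_nhds (I := 𝓘(ℝ, EN)) y] with z hz
    show A (extChartAt 𝓘(ℝ, EN) y ((extChartAt 𝓘(ℝ, EN) y).symm z)) = A z
    rw [(extChartAt 𝓘(ℝ, EN) y).right_inv hz]
  have h4 : mfderiv 𝓘(ℝ, EN) 𝓘(ℝ, ℝ) (fun x => b x • A (extChartAt 𝓘(ℝ, EN) y x)) y = α :=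
    (h1.mfderiv_eq).trans h2.mfderiv
  ext v
  exact DFunLike.congr_fun h4 v

theorem differential_comp {f : N → ℝ} {p : S → N} {s : S}
    (hf : MDifferentiableAt 𝓘(ℝ, EN) 𝓘(ℝ, ℝ) f (p s))
    (hp : MDifferentiableAt 𝓘(ℝ, ES) 𝓘(ℝ, EN) p s) (v : TangentSpace 𝓘(ℝ, ES) s) :
    differential (E := ES) (fun t => f (p t)) s v =
      differential f (p s) (mfderiv 𝓘(ℝ, ES) 𝓘(ℝ, EN) p s v) :=
  mfderiv_comp_apply s hf hp v

/-- The chain rule with the base point given only up to `f s = y` and the values read in the model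
space, so that identities such as `g⁻¹ • g • x = x` need no transport between tangent spaces. -/
theorem mfderiv_apply_of_eq_comp {EP : Type*} [NormedAddCommGroup EP] [NormedSpace ℝ EP]
    {P : Type*} [TopologicalSpace P] [ChartedSpace EP P] {f : S → N} {g : N → P} {h : S → P}
    {s : S} {y : N} (hh : ∀ t, h t = g (f t)) (hg : MDifferentiableAt 𝓘(ℝ, EN) 𝓘(ℝ, EP) g y)
    (hf : MDifferentiableAt 𝓘(ℝ, ES) 𝓘(ℝ, EN) f s) (hy : f s = y) (v : TangentSpace 𝓘(ℝ, ES) s) :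
    (mfderiv 𝓘(ℝ, ES) 𝓘(ℝ, EP) h s v : EP) =
      mfderiv 𝓘(ℝ, EN) 𝓘(ℝ, EP) g y (mfderiv 𝓘(ℝ, ES) 𝓘(ℝ, EN) f s v : EN) := by
  obtain rfl : h = g ∘ f := funext hh
  subst hy
  exact mfderiv_comp_apply s hg hf v

/-- The cotangent spaces vary with the point, so the differentials are moved by a chart to the fixed
dual of the model space, where they vary continuously and independence is an open condition. -/
theorem isOpen_setOf_linearIndependent_differential [IsManifold 𝓘(ℝ, EN) ∞ N]
    {ι : Type*} [Finite ι] (f : ι → C^∞⟮𝓘(ℝ, EN), N; ℝ⟯) :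
    IsOpen {y : N | LinearIndependent ℝ fun i => differential (E := EN) (f i) y} := by
  have := Fintype.ofFinite ι
  rw [isOpen_iff_mem_nhds]
  intro y₀ hy₀
  set φ := extChartAt 𝓘(ℝ, EN) y₀ with hφ
  have key : ∀ y ∈ φ.source, (LinearIndependent ℝ fun i => differential (E := EN) (f i) y) ↔
      LinearIndependent ℝ fun i => fderiv ℝ (f i ∘ φ.symm) (φ y) := by
    intro y hy
    have hy' : y ∈ (chartAt EN y₀).source := by simpa [hφ] using hy
    obtain ⟨e, he⟩ := isInvertible_mfderiv_extChartAt (I := 𝓘(ℝ, EN)) (x := y₀) hy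
    let A : TangentSpace 𝓘(ℝ, EN) y →L[ℝ] EN :=
      (e : TangentSpace 𝓘(ℝ, EN) y →L[ℝ] TangentSpace 𝓘(ℝ, EN) (φ y))
    let L : (EN →L[ℝ] ℝ) →ₗ[ℝ] Cotangent EN y :=
      { toFun := fun β => β.comp A
        map_add' := fun _ _ => rfl
        map_smul' := fun _ _ => rfl }
    have hL : LinearMap.ker L = ⊥ := by
      refine LinearMap.ker_eq_bot'.2 fun β hβ => ?_
      ext v
      have := DFunLike.congr_fun hβ (e.symm v)
      have h0 : A (e.symm v) = v := e.apply_symm_apply v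
      exact (congrArg β h0.symm).trans this
    suffices hfun : (fun i => differential (E := EN) (f i) y) =
        L ∘ fun i => fderiv ℝ (f i ∘ φ.symm) (φ y) by
      rw [hfun, LinearMap.linearIndependent_iff L hL]
    funext i
    have h1 : MDifferentiableAt 𝓘(ℝ, EN) 𝓘(ℝ, EN) φ y :=
      (contMDiffAt_extChartAt' (n := 1) hy').mdifferentiableAt (by simp)
    have h2 : ContMDiffAt 𝓘(ℝ, EN) 𝓘(ℝ, ℝ) ∞ (f i ∘ φ.symm) (φ y) := by
      refine ContMDiffAt.comp (φ y) ((f i).contMDiff _) ?_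
      exact (contMDiffOn_extChartAt_symm y₀).contMDiffAt (extChartAt_target_mem_nhds' (φ.map_source hy))
    have h3 := (h2.mdifferentiableAt (by simp)).hasMFDerivAt.comp y h1.hasMFDerivAt
    have h4 : f i =ᶠ[𝓝 y] (f i ∘ φ.symm) ∘ φ := by
      filter_upwards [extChartAt_source_mem_nhds' hy] with z hz
      simp [φ.left_inv hz]
    have h5 := (h3.congr_of_eventuallyEq h4).mfderiv
    ext v
    have h6 := DFunLike.congr_fun h5 v
    refine h6.trans ?_
    rw [mfderiv_eq_fderiv, ← he]
    rfl
  have hcont : ContinuousAt (fun y i => fderiv ℝ (f i ∘ φ.symm) (φ y)) y₀ := by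
    refine continuousAt_pi.2 fun i => ?_
    have h2 : ContMDiffAt 𝓘(ℝ, EN) 𝓘(ℝ, ℝ) ∞ (f i ∘ φ.symm) (φ y₀) := by
      refine ContMDiffAt.comp (φ y₀) ((f i).contMDiff _) ?_
      exact (contMDiffOn_extChartAt_symm y₀).contMDiffAt (extChartAt_target_mem_nhds y₀)
    exact (h2.contDiffAt.continuousAt_fderiv (by simp)).comp (continuousAt_extChartAt y₀)
  have hopen : IsOpen {g : ι → EN →L[ℝ] ℝ | LinearIndependent ℝ g} :=
    isOpen_setOfPred_linearIndependent
  have h7 := hcont.eventually_mem (hopen.mem_nhds ((key y₀ (mem_extChartAt_source y₀)).1 hy₀))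
  filter_upwards [h7, extChartAt_source_mem_nhds (I := 𝓘(ℝ, EN)) y₀] with y hy1 hy2
  exact (key y hy2).2 hy1

end SmoothMaps

/-! ### Linear algebra of coisotropic subspaces -/

section Coisotropic

open Module

variable {W : Type*} [AddCommGroup W] [Module ℝ W]

/-- The kernel of the restriction of a bilinear form to a subspace. -/
def restrictedKernel (B : LinearMap.BilinForm ℝ W) (F : Submodule ℝ W) : Submodule ℝ W :=
  F ⊓ ⨅ β ∈ F, LinearMap.ker (B.flip β)

theorem mem_restrictedKernel {B : LinearMap.BilinForm ℝ W} {F : Submodule ℝ W} {a : W} :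
    a ∈ restrictedKernel B F ↔ a ∈ F ∧ ∀ b ∈ F, B a b = 0 := by
  simp [restrictedKernel, Submodule.mem_iInf]

theorem restrictedKernel_eq_inf_orthogonal {B : LinearMap.BilinForm ℝ W} (hB : B.IsRefl)
    (F : Submodule ℝ W) : restrictedKernel B F = F ⊓ B.orthogonal F := by
  ext a
  rw [mem_restrictedKernel, Submodule.mem_inf, LinearMap.BilinForm.mem_orthogonal_iff]
  exact and_congr_right fun _ => forall₂_congr fun b _ => ⟨fun h => hB _ _ h, fun h => hB _ _ h⟩

/-- The restricted kernel `F ∩ F^⊥` always lies in `F^⊥`, whose dimension is `dim W - dim F`; the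
hypothesis makes the two dimensions equal. -/
theorem orthogonal_le_of_finrank_add_finrank_eq [FiniteDimensional ℝ W]
    {B : LinearMap.BilinForm ℝ W} (hB : B.IsRefl) (hn : B.Nondegenerate) {F : Submodule ℝ W}
    (h : finrank ℝ F + finrank ℝ (restrictedKernel B F) = finrank ℝ W) : B.orthogonal F ≤ F := by
  have h1 := LinearMap.BilinForm.finrank_orthogonal hn F
  have h2 : restrictedKernel B F = B.orthogonal F := by
    refine Submodule.eq_of_le_of_finrank_eq ?_ (by omega)
    rw [restrictedKernel_eq_inf_orthogonal hB]
    exact inf_le_right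
  rw [← h2]
  exact inf_le_left

theorem finrank_map_of_injective {W' : Type*} [AddCommGroup W'] [Module ℝ W'] {J : W →ₗ[ℝ] W'}
    (hJ : Function.Injective J) (F : Submodule ℝ W) : finrank ℝ (F.map J) = finrank ℝ F :=
  (LinearEquiv.finrank_eq (Submodule.equivMapOfInjective J hJ F)).symm

theorem finrank_map_add_finrank_of_ker_le [FiniteDimensional ℝ W] {W' : Type*} [AddCommGroup W']
    [Module ℝ W'] (A : W →ₗ[ℝ] W') {F : Submodule ℝ W} (hF : LinearMap.ker A ≤ F) :
    finrank ℝ (F.map A) + finrank ℝ (LinearMap.ker A) = finrank ℝ F := by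
  have h := LinearMap.finrank_range_add_finrank_ker (A.domRestrict F)
  rw [LinearMap.range_domRestrict] at h
  rw [← h, LinearMap.ker_domRestrict]
  congr 1
  exact (LinearEquiv.finrank_eq (Submodule.comapSubtypeEquivOfLe hF)).symm

/-- Correspondence of restricted kernels along `W --A--> S <--J-- W'`. -/
theorem map_restrictedKernel_eq {W' S : Type*} [AddCommGroup W'] [Module ℝ W'] [AddCommGroup S]
    [Module ℝ S] {B : LinearMap.BilinForm ℝ W} {B' : LinearMap.BilinForm ℝ W'}
    {A : W →ₗ[ℝ] S} {J : W' →ₗ[ℝ] S} {F : Submodule ℝ W} {F' : Submodule ℝ W'}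
    (hF : F'.map J = F.map A)
    (hB : ∀ a ∈ F, ∀ b ∈ F, ∀ a' b', J a' = A a → J b' = A b → B' a' b' = B a b) :
    (restrictedKernel B' F').map J = (restrictedKernel B F).map A := by
  have h1 : ∀ a' ∈ F', ∃ a ∈ F, J a' = A a := fun a' ha' => by
    have : J a' ∈ F.map A := hF ▸ Submodule.mem_map_of_mem ha'
    obtain ⟨a, ha, h⟩ := this
    exact ⟨a, ha, h.symm⟩
  have h2 : ∀ a ∈ F, ∃ a' ∈ F', J a' = A a := fun a ha => by
    have : A a ∈ F'.map J := hF ▸ Submodule.mem_map_of_mem ha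
    exact this
  refine le_antisymm ?_ ?_
  · rintro _ ⟨a', ha', rfl⟩
    obtain ⟨h3, h4⟩ := mem_restrictedKernel.1 ha'
    obtain ⟨a, ha, hJ⟩ := h1 a' h3
    refine ⟨a, mem_restrictedKernel.2 ⟨ha, fun b hb => ?_⟩, hJ.symm⟩
    obtain ⟨b', hb', hJb⟩ := h2 b hb
    rw [← hB a ha b hb a' b' hJ hJb]
    exact h4 b' hb'
  · rintro _ ⟨a, ha, rfl⟩
    obtain ⟨h3, h4⟩ := mem_restrictedKernel.1 ha
    obtain ⟨a', ha', hJ⟩ := h2 a h3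
    refine ⟨a', mem_restrictedKernel.2 ⟨ha', fun b' hb' => ?_⟩, hJ⟩
    obtain ⟨b, hb, hJb⟩ := h1 b' hb'
    rw [hB a h3 b hb a' b' hJ hJb]
    exact h4 b hb

end Coisotropic

/-! ### Pointwise symplectic algebra -/

section SymplecticLinear

open Module

variable {E : Type*} [NormedAddCommGroup E] [NormedSpace ℝ E]
  {M : Type*} [TopologicalSpace M] [ChartedSpace E M]

instance [FiniteDimensional ℝ E] (x : M) : FiniteDimensional ℝ (TangentSpace 𝓘(ℝ, E) x) :=
  inferInstanceAs (FiniteDimensional ℝ E)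

instance [FiniteDimensional ℝ E] (x : M) : FiniteDimensional ℝ (Cotangent E x) :=
  inferInstanceAs (FiniteDimensional ℝ (E →L[ℝ] ℝ))

theorem finrank_continuousDual (E : Type*) [NormedAddCommGroup E] [NormedSpace ℝ E]
    [FiniteDimensional ℝ E] : finrank ℝ (E →L[ℝ] ℝ) = finrank ℝ E := by
  rw [← (LinearMap.toContinuousLinearMap (𝕜 := ℝ) (E := E) (F' := ℝ)).finrank_eq]
  exact Subspace.dual_finrank_eq

theorem finrank_cotangent [FiniteDimensional ℝ E] (x : M) :
    finrank ℝ (Cotangent E x) = finrank ℝ E :=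
  finrank_continuousDual E

variable [IsManifold 𝓘(ℝ, E) ∞ M] (Ω : SymplecticForm E M)

theorem SymplecticForm.form_sharp (x : M) (v : TangentSpace 𝓘(ℝ, E) x) (α : Cotangent E x) :
    Ω.form x v (Ω.sharp x α) = α v := by
  have h : Ω.form x ((Ω.flat x).symm α) = α := (Ω.flat x).apply_symm_apply α
  rw [Ω.form_swap, SymplecticForm.sharp]
  simp [h]

theorem SymplecticForm.eq_of_form_eq {x : M} {v w : TangentSpace 𝓘(ℝ, E) x}
    (h : ∀ u, Ω.form x u v = Ω.form x u w) : v = w := by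
  refine (Ω.nondegenerate x).1 ?_
  ext u
  rw [Ω.form_swap, h, ← Ω.form_swap]

theorem SymplecticForm.sharp_injective (x : M) : Function.Injective (Ω.sharp x) := fun α β h => by
  ext v
  rw [← Ω.form_sharp x v α, h, Ω.form_sharp]

theorem SymplecticForm.sharp_surjective (x : M) : Function.Surjective (Ω.sharp x) := fun v =>
  ⟨-Ω.flat x v, by simp [SymplecticForm.sharp]⟩

theorem SymplecticForm.bivector_apply (x : M) (α β : Cotangent E x) :
    Ω.bivector x α β = α (Ω.sharp x β) := rfl

theorem SymplecticForm.bivector_swap (x : M) (α β : Cotangent E x) :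
    Ω.bivector x α β = -Ω.bivector x β α := by
  rw [bivector_apply, bivector_apply, ← Ω.form_sharp, Ω.form_swap, Ω.form_sharp]

theorem SymplecticForm.bivector_isRefl (x : M) : (Ω.bivector x).IsRefl := fun α β h => by
  rw [Ω.bivector_swap, h, neg_zero]

theorem SymplecticForm.bivector_nondegenerate (x : M) : (Ω.bivector x).Nondegenerate := by
  have h : (Ω.bivector x).SeparatingLeft := fun α hα => by
    ext v
    obtain ⟨β, rfl⟩ := Ω.sharp_surjective x v
    exact hα β
  exact ⟨h, fun β hβ => h β fun α => by rw [Ω.bivector_swap, hβ, neg_zero]⟩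

theorem SymplecticForm.corank_bivector (x : M) : corank Ω.bivector x = 0 := by
  have h : LinearMap.ker (Ω.bivector x) = ⊥ :=
    LinearMap.ker_eq_bot'.2 fun α hα => (Ω.bivector_nondegenerate x).1 α fun β => by
      rw [hα, LinearMap.zero_apply]
  rw [corank, h, finrank_bot]

end SymplecticLinear

/-! ### Orbit maps of smooth actions -/

section SmoothActions

open Filter Topology

section

variable (EG : Type*) [NormedAddCommGroup EG] [NormedSpace ℝ EG]
  {G : Type*} [TopologicalSpace G] [ChartedSpace EG G] [Group G]
  {E : Type*} [NormedAddCommGroup E] [NormedSpace ℝ E]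
  {M : Type*} [TopologicalSpace M] [ChartedSpace E M] [MulAction G M]

theorem contMDiff_orbitMap [ContMDiffSMul 𝓘(ℝ, EG) 𝓘(ℝ, E) ∞ G M] (x : M) :
    ContMDiff 𝓘(ℝ, EG) 𝓘(ℝ, E) ∞ (fun g : G => g • x) :=
  contMDiff_id.smul contMDiff_const

theorem contMDiff_smul_left [ContMDiffSMul 𝓘(ℝ, EG) 𝓘(ℝ, E) ∞ G M] (g : G) :
    ContMDiff 𝓘(ℝ, E) 𝓘(ℝ, E) ∞ (fun x : M => g • x) :=
  (contMDiff_const (I' := 𝓘(ℝ, EG)) (c := g)).smul contMDiff_id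

theorem mdifferentiable_orbitMap [ContMDiffSMul 𝓘(ℝ, EG) 𝓘(ℝ, E) ∞ G M] (x : M) :
    MDifferentiable 𝓘(ℝ, EG) 𝓘(ℝ, E) (fun g : G => g • x) :=
  (contMDiff_orbitMap EG x).mdifferentiable (by simp)

theorem mdifferentiable_smul_left [ContMDiffSMul 𝓘(ℝ, EG) 𝓘(ℝ, E) ∞ G M] (g : G) :
    MDifferentiable 𝓘(ℝ, E) 𝓘(ℝ, E) (fun x : M => g • x) :=
  (contMDiff_smul_left EG g).mdifferentiable (by simp)

theorem mfderiv_smul_left_surjective [ContMDiffSMul 𝓘(ℝ, EG) 𝓘(ℝ, E) ∞ G M] (g : G) (x : M) :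
    Function.Surjective (mfderiv 𝓘(ℝ, E) 𝓘(ℝ, E) (fun y : M => g • y) x) := by
  intro v
  have h1 := mfderiv_apply_of_eq_comp (h := id) (fun y => (smul_inv_smul g y).symm)
    (mdifferentiable_smul_left EG g x) (mdifferentiable_smul_left EG g⁻¹ (g • x))
    (inv_smul_smul g x) v
  refine ⟨_, h1.symm.trans ?_⟩
  have h2 := mfderiv_id (I := 𝓘(ℝ, E)) (x := g • x)
  exact DFunLike.congr_fun h2 v

end

variable {EG : Type*} [NormedAddCommGroup EG] [NormedSpace ℝ EG]
  {G : Type*} [TopologicalSpace G] [ChartedSpace EG G] [Group G] [LieGroup 𝓘(ℝ, EG) ∞ G]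
  {E : Type*} [NormedAddCommGroup E] [NormedSpace ℝ E]
  {M : Type*} [TopologicalSpace M] [ChartedSpace E M]
  [MulAction G M] [ContMDiffSMul 𝓘(ℝ, EG) 𝓘(ℝ, E) ∞ G M]

/-- Every derivative of the orbit map is an infinitesimal generator at the moved point. -/
theorem exists_mfderiv_orbitMap_eq (x : M) (g : G) (v : TangentSpace 𝓘(ℝ, EG) g) :
    ∃ ξ : GroupLieAlgebra 𝓘(ℝ, EG) G,
      (mfderiv 𝓘(ℝ, EG) 𝓘(ℝ, E) (fun a : G => a • x) g v : E) =
        mfderiv 𝓘(ℝ, EG) 𝓘(ℝ, E) (fun a : G => a • (g • x)) 1 ξ := by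
  have hR : MDifferentiableAt 𝓘(ℝ, EG) 𝓘(ℝ, EG) (fun a : G => a * g⁻¹) g :=
    (contMDiff_mul_right (n := ∞)).mdifferentiable (by simp) g
  exact ⟨_, mfderiv_apply_of_eq_comp (fun a => by simp [smul_smul])
    (mdifferentiable_orbitMap EG (E := E) (g • x) 1) hR (mul_inv_cancel g) v⟩

/-- In a free action the infinitesimal generators do not vanish. -/
theorem orbitMap_mfderiv_injective [FiniteDimensional ℝ EG] [IsManifold 𝓘(ℝ, E) ∞ M]
    (hfree : ∀ (g : G) (x : M), g • x = x → g = 1)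
    (x : M) (ξ : GroupLieAlgebra 𝓘(ℝ, EG) G)
    (h0 : (mfderiv 𝓘(ℝ, EG) 𝓘(ℝ, E) (fun a : G => a • x) 1 ξ : E) = 0) : ξ = 0 := by
  have : CompleteSpace EG := FiniteDimensional.complete ℝ EG
  have : LieGroup 𝓘(ℝ, EG) (minSmoothness ℝ 3) G := by
    rw [minSmoothness_of_isRCLikeNormedField]
    exact LieGroup.of_le (n := ∞) (by norm_cast)
  have hv : ContMDiffAt 𝓘(ℝ, EG) 𝓘(ℝ, EG).tangent 1
      (fun g : G => (⟨g, mulInvariantVectorField ξ g⟩ : TangentBundle 𝓘(ℝ, EG) G)) 1 := by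
    refine (contMDiff_mulInvariantVectorField ξ).contMDiffAt.of_le ?_
    rw [minSmoothness_of_isRCLikeNormedField]
    norm_num
  -- The integral curve of the left-invariant field of `ξ` plays the role of `exp (tξ)`; only its
  -- germ at `0` is needed.
  obtain ⟨γ, hγ0, hγ⟩ := exists_isMIntegralCurveAt_of_contMDiffAt_boundaryless 0 hv
  have hγ' : ∀ᶠ t in 𝓝 (0 : ℝ), HasMFDerivAt 𝓘(ℝ, ℝ) 𝓘(ℝ, EG) γ t
      ((1 : ℝ →L[ℝ] ℝ).smulRight (mulInvariantVectorField ξ (γ t))) := by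
    obtain ⟨u, hu, hu'⟩ := isMIntegralCurveAt_iff.1 hγ
    filter_upwards [eventually_mem_nhds_iff.2 hu] with t ht
    exact (hu'.isMIntegralCurveAt ht).hasMFDerivAt
  have hdiff : ∀ᶠ t in 𝓝 (0 : ℝ), MDifferentiableAt 𝓘(ℝ, ℝ) 𝓘(ℝ, E) (fun t => γ t • x) t :=
    hγ'.mono fun t ht => (mdifferentiable_orbitMap EG (E := E) x (γ t)).comp t ht.mdifferentiableAt
  have hzero : ∀ᶠ t in 𝓝 (0 : ℝ), ∀ v : TangentSpace 𝓘(ℝ, ℝ) t,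
      (mfderiv 𝓘(ℝ, ℝ) 𝓘(ℝ, E) (fun t => γ t • x) t v : E) = 0 := by
    filter_upwards [hγ'] with t ht v
    have hL : MDifferentiableAt 𝓘(ℝ, EG) 𝓘(ℝ, EG) (fun a : G => γ t * a) 1 :=
      (contMDiff_mul_left (n := ∞)).mdifferentiable (by simp) 1
    -- The map `a ↦ (γ t * a) • x` is factored in two ways. The second factors through `a ↦ a • x`,
    -- whose derivative kills `ξ`, so the orbit map has zero derivative along the left-invariant
    -- field.
    have e1 := mfderiv_apply_of_eq_comp (h := fun a : G => (γ t * a) • x) (f := fun a => γ t * a)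
      (g := fun a => a • x) (fun _ => rfl) (mdifferentiable_orbitMap EG (E := E) x (γ t)) hL
      (mul_one (γ t)) ξ
    have e2 := mfderiv_apply_of_eq_comp (fun a : G => mul_smul (γ t) a x)
      (mdifferentiable_smul_left EG (γ t) x) (mdifferentiable_orbitMap EG (E := E) x 1) (one_smul G x) ξ
    have e3 : (mfderiv 𝓘(ℝ, EG) 𝓘(ℝ, E) (fun a : G => a • x) (γ t)
        (mulInvariantVectorField ξ (γ t)) : E) = 0 := by
      refine e1.symm.trans (e2.trans ?_)
      rw [h0]
      exact map_zero _
    refine (mfderiv_comp_apply t (mdifferentiable_orbitMap EG (E := E) x (γ t))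
      ht.mdifferentiableAt v).trans ?_
    rw [ht.mfderiv]
    let r : ℝ := v
    refine (map_smul (mfderiv 𝓘(ℝ, EG) 𝓘(ℝ, E) (fun a : G => a • x) (γ t)) r
      (mulInvariantVectorField ξ (γ t))).trans ?_
    exact (congrArg (fun w : E => r • w) e3).trans (smul_zero (A := E) r)
  have hconst : ∀ᶠ t in 𝓝 (0 : ℝ), γ t • x = γ 0 • x :=
    eventually_eq_of_mfderiv_eq_zero hdiff hzero
  have hγ1 : γ =ᶠ[𝓝 0] fun _ => 1 := by
    filter_upwards [hconst] with t ht
    rw [hγ0, one_smul] at ht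
    exact hfree _ _ ht
  have h1 := hγ'.self_of_nhds
  have h2 : HasMFDerivAt 𝓘(ℝ, ℝ) 𝓘(ℝ, EG) γ 0 0 :=
    (hasMFDerivAt_const (1 : G) (0 : ℝ)).congr_of_eventuallyEq hγ1
  have h3 : ((1 : ℝ) • mulInvariantVectorField ξ (γ 0) : EG) = 0 :=
    DFunLike.congr_fun (hasMFDerivAt_unique h1 h2) (1 : ℝ)
  rw [one_smul, hγ0] at h3
  have h4 : (mulInvariantVectorField ξ (1 : G) : EG) = ξ := by
    have : (fun a : G => 1 * a) = id := funext one_mul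
    rw [mulInvariantVectorField, this]
    exact DFunLike.congr_fun mfderiv_id ξ
  exact h4.symm.trans h3

end SmoothActions

/-! ### Commuting moments make the group commutative -/

section HamiltonianActions

variable {EG : Type*} [NormedAddCommGroup EG] [NormedSpace ℝ EG]
  {G : Type*} [TopologicalSpace G] [ChartedSpace EG G] [Group G]
  {E : Type*} [NormedAddCommGroup E] [NormedSpace ℝ E]
  {M : Type*} [TopologicalSpace M] [ChartedSpace E M] [IsManifold 𝓘(ℝ, E) ∞ M]
  [MulAction G M]
  {Ω : SymplecticForm E M} {Φ : M → LieDual EG G}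

theorem IsHamiltonianAction.mdifferentiable (hΦ : IsHamiltonianAction Ω Φ)
    (ξ : GroupLieAlgebra 𝓘(ℝ, EG) G) :
    MDifferentiable 𝓘(ℝ, E) 𝓘(ℝ, ℝ) (fun x => Φ x ξ) :=
  (hΦ.smooth ξ).mdifferentiable (by simp)

/-- Noether's theorem: `g ↦ f (g • x)` is constant, and its derivative at `1` along `ξ` is `df` on
the generator. -/
theorem differential_hamiltonianField_of_invariant [ContMDiffSMul 𝓘(ℝ, EG) 𝓘(ℝ, E) ∞ G M]
    (hΦ : IsHamiltonianAction Ω Φ) {f : M → ℝ}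
    (hf : MDifferentiable 𝓘(ℝ, E) 𝓘(ℝ, ℝ) f) (hinv : ∀ (g : G) x, f (g • x) = f x) (x : M)
    (ξ : GroupLieAlgebra 𝓘(ℝ, EG) G) :
    differential f x (Ω.hamiltonianField (fun y => Φ y ξ) x) = 0 := by
  have h1 := mfderiv_apply_of_eq_comp (fun g : G => (hinv g x).symm) (hf x)
    (mdifferentiable_orbitMap EG (E := E) x 1) (one_smul G x) ξ
  rw [mfderiv_const, hΦ.generator ξ x] at h1
  exact h1.symm

/-- Every derivative of `g ↦ φ_ξ (g • x)` is a bracket `{φ_ξ, φ_ζ}` at `g • x`, hence zero, and `G`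
is connected. -/
theorem moment_smul_of_commute [LieGroup 𝓘(ℝ, EG) ∞ G]
    [ContMDiffSMul 𝓘(ℝ, EG) 𝓘(ℝ, E) ∞ G M] (hΦ : IsHamiltonianAction Ω Φ)
    (hcomm : ∀ (ξ ζ : GroupLieAlgebra 𝓘(ℝ, EG) G) x,
      poissonBracket Ω.bivector (fun y => Φ y ξ) (fun y => Φ y ζ) x = 0)
    [PreconnectedSpace G] (g : G) (x : M)
    (ξ : GroupLieAlgebra 𝓘(ℝ, EG) G) : Φ (g • x) ξ = Φ x ξ := by
  have h := eq_of_mfderiv_eq_zero (f := fun g : G => Φ (g • x) ξ) (ES := EG) (EN := ℝ)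
    (fun g => ((hΦ.mdifferentiable ξ).comp (mdifferentiable_orbitMap EG (E := E) x)) g)
    (fun g v => by
      obtain ⟨ζ, hζ⟩ := exists_mfderiv_orbitMap_eq (E := E) x g v
      rw [hΦ.generator] at hζ
      refine (mfderiv_comp_apply g (hΦ.mdifferentiable ξ _)
        (mdifferentiable_orbitMap EG (E := E) x g) v).trans ?_
      refine Eq.trans ?_ (hcomm ξ ζ (g • x))
      exact congrArg (differential (fun y => Φ y ξ) (g • x)) hζ) g 1
  simpa using h

/-- The diffeomorphism `g` preserves both the form and, by `moment_smul_of_commute`, the function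
`φ_ξ`; so it preserves the Hamiltonian field. -/
theorem mfderiv_smul_hamiltonianField [LieGroup 𝓘(ℝ, EG) ∞ G]
    [ContMDiffSMul 𝓘(ℝ, EG) 𝓘(ℝ, E) ∞ G M] (hΦ : IsHamiltonianAction Ω Φ)
    (hcomm : ∀ (ξ ζ : GroupLieAlgebra 𝓘(ℝ, EG) G) x,
      poissonBracket Ω.bivector (fun y => Φ y ξ) (fun y => Φ y ζ) x = 0)
    [PreconnectedSpace G] (g : G) (x : M)
    (ξ : GroupLieAlgebra 𝓘(ℝ, EG) G) :
    mfderiv 𝓘(ℝ, E) 𝓘(ℝ, E) (fun y : M => g • y) x (Ω.hamiltonianField (fun y => Φ y ξ) x) =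
      Ω.hamiltonianField (fun y => Φ y ξ) (g • x) := by
  refine Ω.eq_of_form_eq fun u => ?_
  obtain ⟨v, rfl⟩ := mfderiv_smul_left_surjective EG g x u
  rw [hΦ.symplectic, Ω.form_hamiltonianField, Ω.form_hamiltonianField,
    ← differential_comp (hΦ.mdifferentiable ξ _) (mdifferentiable_smul_left EG g x)]
  congr 2
  funext y
  exact (moment_smul_of_commute hΦ hcomm g y ξ).symm

/-- The map `c ↦ c⁻¹ • g • c • x` is shown to have zero derivative, at `1` by invariance of the
generators under `g` and elsewhere by translation. Connectedness makes it constant, and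
effectiveness turns this into an identity in `G`. -/
theorem mul_comm_of_moment_commute [LieGroup 𝓘(ℝ, EG) ∞ G]
    [ContMDiffSMul 𝓘(ℝ, EG) 𝓘(ℝ, E) ∞ G M] [FaithfulSMul G M] (hΦ : IsHamiltonianAction Ω Φ)
    (hcomm : ∀ (ξ ζ : GroupLieAlgebra 𝓘(ℝ, EG) G) x,
      poissonBracket Ω.bivector (fun y => Φ y ξ) (fun y => Φ y ζ) x = 0)
    [PreconnectedSpace G] (a b : G) : a * b = b * a := by
  have hinv : ContMDiff 𝓘(ℝ, EG) 𝓘(ℝ, EG) ∞ (fun c : G => c⁻¹) := contMDiff_inv _ _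
  have hK : ∀ (g : G) (x : M),
      ContMDiff 𝓘(ℝ, EG) 𝓘(ℝ, E) ∞ (fun c : G => c⁻¹ • (g • (c • x))) := fun g x =>
    hinv.smul (ContMDiff.smul (I := 𝓘(ℝ, EG)) contMDiff_const
      (ContMDiff.smul (I := 𝓘(ℝ, EG)) contMDiff_id contMDiff_const))
  have hKd := fun g x => (hK g x).mdifferentiable (n := ∞) (by simp)
  have h1 : ∀ (g : G) (x : M) (v : GroupLieAlgebra 𝓘(ℝ, EG) G),
      (mfderiv 𝓘(ℝ, EG) 𝓘(ℝ, E) (fun c : G => c⁻¹ • (g • (c • x))) 1 v : E) = 0 := by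
    intro g x v
    have hK1 : (1 : G)⁻¹ • g • (1 : G) • x = g • x := by simp
    have hΨ : MDifferentiableAt (𝓘(ℝ, EG).prod 𝓘(ℝ, E)) 𝓘(ℝ, E)
        (fun p : G × M => p.1 • p.2) ((1 : G), (1 : G)⁻¹ • g • (1 : G) • x) :=
      (contMDiff_smul (I := 𝓘(ℝ, EG)) (n := ∞)).mdifferentiable (by simp) _
    have hpair : MDifferentiableAt 𝓘(ℝ, EG) (𝓘(ℝ, EG).prod 𝓘(ℝ, E))
        (fun c : G => (c, c⁻¹ • (g • (c • x)))) 1 :=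
      mdifferentiableAt_id.prodMk (hKd g x 1)
    -- The identity `c • (c⁻¹ • g • c • x) = g • (c • x)` is differentiated at `c = 1`. The right
    -- side gives the image under `g` of a generator, which is the generator at `g • x`. The left
    -- side gives this same generator plus the derivative in question, which must therefore vanish.
    have e1 := mfderiv_comp_apply (1 : G) hΨ hpair v
    have e2 := mfderiv_apply_of_eq_comp
      (h := (fun p : G × M => p.1 • p.2) ∘ fun c : G => (c, c⁻¹ • (g • (c • x))))
      (f := fun c => c • x) (g := fun y => g • y)
      (fun c => by simp) (mdifferentiable_smul_left EG g x) (mdifferentiable_orbitMap EG (E := E) x 1)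
      (one_smul G x) v
    rw [hΦ.generator, mfderiv_smul_hamiltonianField hΦ hcomm, ← hΦ.generator, e1,
      mfderiv_prod_eq_add_apply hΨ] at e2
    have e3 : mfderiv 𝓘(ℝ, EG) (𝓘(ℝ, EG).prod 𝓘(ℝ, E))
        (fun c : G => (c, c⁻¹ • (g • (c • x)))) 1 = (mfderiv 𝓘(ℝ, EG) 𝓘(ℝ, EG) id (1 : G)).prod
          (mfderiv 𝓘(ℝ, EG) 𝓘(ℝ, E) (fun c : G => c⁻¹ • (g • (c • x))) 1) :=
      mdifferentiableAt_id.mfderiv_prod (hKd g x 1)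
    rw [e3, mfderiv_id] at e2
    have e4 : (mfderiv 𝓘(ℝ, EG) 𝓘(ℝ, E) (fun c : G => c • ((1 : G)⁻¹ • g • (1 : G) • x)) 1 v : E) =
        mfderiv 𝓘(ℝ, EG) 𝓘(ℝ, E) (fun c : G => c • (g • x)) 1 v := by
      rw [hK1]
    have e5 : ∀ (y : M) (w : E),
        (mfderiv 𝓘(ℝ, E) 𝓘(ℝ, E) (fun z : M => (1 : G) • z) y w : E) = w := fun y w => by
      have : (fun z : M => (1 : G) • z) = id := funext (one_smul G)
      rw [this]
      exact DFunLike.congr_fun (mfderiv_id (I := 𝓘(ℝ, E)) (x := y)) w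
    have e6 : ∀ p q r : E, p + q = r → p = r → q = 0 := fun p q r h h' => by
      rw [h', add_eq_left] at h
      exact h
    exact (e5 _ _).symm.trans (e6 _ _ _ e2 e4)
  have h2 : ∀ (g : G) (x : M) (c : G) (v : TangentSpace 𝓘(ℝ, EG) c),
      (mfderiv 𝓘(ℝ, EG) 𝓘(ℝ, E) (fun c : G => c⁻¹ • (g • (c • x))) c v : E) = 0 := by
    intro g x c v
    have hR : MDifferentiableAt 𝓘(ℝ, EG) 𝓘(ℝ, EG) (fun d : G => d * c⁻¹) c :=
      (contMDiff_mul_right (n := ∞)).mdifferentiable (by simp) c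
    -- Writing a group element near `c` as `d * c`, one has `(d * c)⁻¹ • g • (d * c) • x = c⁻¹ •
    -- (d⁻¹ • g • d • (c • x))`. This reduces the derivative at `c` to the derivative at `1` with `c
    -- • x` in place of `x`.
    have e1 := fun w => mfderiv_apply_of_eq_comp (s := (1 : G))
      (h := fun d : G => c⁻¹ • (d⁻¹ • (g • (d • (c • x))))) (fun d => rfl)
      (mdifferentiable_smul_left EG c⁻¹ _) (hKd g (c • x) 1) rfl w
    have e2 := mfderiv_apply_of_eq_comp (s := c) (h := fun c : G => c⁻¹ • (g • (c • x)))
      (g := fun d : G => c⁻¹ • (d⁻¹ • (g • (d • (c • x)))))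
      (fun d => by simp [smul_smul, mul_assoc])
      (((mdifferentiable_smul_left EG c⁻¹).comp (hKd g (c • x))) 1) hR (mul_inv_cancel c) v
    refine e2.trans ((e1 _).trans ?_)
    exact (congrArg _ (h1 g (c • x) _)).trans (map_zero _)
  have h3 : ∀ x : M, (b⁻¹ * a * b) • x = a • x := fun x => by
    have := eq_of_mfderiv_eq_zero (hKd a x) (h2 a x) b 1
    simpa [smul_smul, mul_assoc] using this
  have h4 : b⁻¹ * a * b = a := FaithfulSMul.eq_of_smul_eq_smul h3
  calc a * b = b * (b⁻¹ * a * b) := by group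
    _ = b * a := by rw [h4]

/-- The bracket is again a component of the moment map, `φ_[ξ,ζ]`, so it is continuous and
determined by its values on a dense set. -/
theorem poissonBracket_moment_eq_zero_of_dense (hΦ : IsHamiltonianAction Ω Φ) {U : Set M}
    (hU : Dense U) (h : ∀ x ∈ U, ∀ ξ ζ : GroupLieAlgebra 𝓘(ℝ, EG) G,
      poissonBracket Ω.bivector (fun y => Φ y ξ) (fun y => Φ y ζ) x = 0)
    (ξ ζ : GroupLieAlgebra 𝓘(ℝ, EG) G) (x : M) :
    poissonBracket Ω.bivector (fun y => Φ y ξ) (fun y => Φ y ζ) x = 0 := by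
  rw [← hΦ.bracket]
  have h1 : (fun y => Φ y ⁅ξ, ζ⁆) = fun _ => 0 :=
    Continuous.ext_on hU (hΦ.smooth _).continuous continuous_const fun y hy => by
      rw [hΦ.bracket]
      exact h y hy ξ ζ
  exact congrFun h1 x

end HamiltonianActions

/-! ### Pullback of covectors -/

section Pullback

variable {ES : Type*} [NormedAddCommGroup ES] [NormedSpace ℝ ES]
  {S : Type*} [TopologicalSpace S] [ChartedSpace ES S]
  {EN : Type*} [NormedAddCommGroup EN] [NormedSpace ℝ EN]
  {N : Type*} [TopologicalSpace N] [ChartedSpace EN N]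

variable (ES EN) in
/-- The pullback of covectors along the derivative of a map. -/
def pullbackCotangent (f : S → N) (s : S) : Cotangent EN (f s) →ₗ[ℝ] Cotangent ES s where
  toFun β := β.comp (mfderiv 𝓘(ℝ, ES) 𝓘(ℝ, EN) f s)
  map_add' _ _ := rfl
  map_smul' _ _ := rfl

theorem pullbackCotangent_apply (f : S → N) (s : S) (β : Cotangent EN (f s))
    (v : TangentSpace 𝓘(ℝ, ES) s) :
    pullbackCotangent ES EN f s β v = β (mfderiv 𝓘(ℝ, ES) 𝓘(ℝ, EN) f s v) := rfl

theorem pullbackCotangent_differential {f : S → N} {s : S} {g : N → ℝ}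
    (hg : MDifferentiableAt 𝓘(ℝ, EN) 𝓘(ℝ, ℝ) g (f s))
    (hf : MDifferentiableAt 𝓘(ℝ, ES) 𝓘(ℝ, EN) f s) :
    pullbackCotangent ES EN f s (differential g (f s)) = differential (fun t => g (f t)) s := by
  ext v
  exact (differential_comp hg hf v).symm

theorem pullbackCotangent_injective {f : S → N} {s : S}
    (hs : Function.Surjective (mfderiv 𝓘(ℝ, ES) 𝓘(ℝ, EN) f s)) :
    Function.Injective (pullbackCotangent ES EN f s) := fun a b h => by
  ext v
  obtain ⟨u, rfl⟩ := hs v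
  exact DFunLike.congr_fun h u

theorem ContMDiffMap.mdifferentiable_real (f : C^∞⟮𝓘(ℝ, EN), N; ℝ⟯) :
    MDifferentiable 𝓘(ℝ, EN) 𝓘(ℝ, ℝ) f :=
  f.contMDiff.mdifferentiable (by simp)

theorem differential_mem_differentialSpan {F : Set C^∞⟮𝓘(ℝ, EN), N; ℝ⟯}
    {f : C^∞⟮𝓘(ℝ, EN), N; ℝ⟯} (hf : f ∈ F) (y : N) :
    differential (E := EN) f y ∈ differentialSpan F y :=
  Submodule.subset_span ⟨f, hf, rfl⟩

theorem differentialSpan_mono {F F' : Set C^∞⟮𝓘(ℝ, EN), N; ℝ⟯} (h : F ⊆ F') (y : N) :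
    differentialSpan F y ≤ differentialSpan F' y :=
  Submodule.span_mono fun _ ⟨f, hf, e⟩ => ⟨f, h hf, e⟩

end Pullback

/-! ### Reduction of complete algebras along `M ← S → N` -/

section Reduction

open Module

variable {E : Type*} [NormedAddCommGroup E] [NormedSpace ℝ E]
  {M : Type*} [TopologicalSpace M] [ChartedSpace E M]
  {ES : Type*} [NormedAddCommGroup ES] [NormedSpace ℝ ES]
  {S : Type*} [TopologicalSpace S] [ChartedSpace ES S]
  {EN : Type*} [NormedAddCommGroup EN] [NormedSpace ℝ EN]
  {N : Type*} [TopologicalSpace N] [ChartedSpace EN N]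

/-- `N` is a Poisson reduction of `M`: the functions in `A` restrict along `ι : S → M` and descend
along the submersion `π : S → N`, compatibly with the brackets. -/
structure IsReduction (Λ : BivectorField E M) (ΛN : BivectorField EN N)
    (A : Set C^∞⟮𝓘(ℝ, E), M; ℝ⟯) (ES : Type*) [NormedAddCommGroup ES] [NormedSpace ℝ ES]
    {S : Type*} [TopologicalSpace S] [ChartedSpace ES S] (ι : S → M) (π : S → N) : Prop where
  contMDiff_left : ContMDiff 𝓘(ℝ, ES) 𝓘(ℝ, E) ∞ ι
  contMDiff_right : ContMDiff 𝓘(ℝ, ES) 𝓘(ℝ, EN) ∞ π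
  surjective : Function.Surjective π
  submersion : ∀ s, Function.Surjective (mfderiv 𝓘(ℝ, ES) 𝓘(ℝ, EN) π s)
  const : ∀ f ∈ A, ∀ s t, π s = π t → f (ι s) = f (ι t)
  bivector : ∀ s, ∀ α ∈ differentialSpan A (ι s), ∀ β ∈ differentialSpan A (ι s), ∀ a b,
    pullbackCotangent ES EN π s a = pullbackCotangent ES E ι s α →
    pullbackCotangent ES EN π s b = pullbackCotangent ES E ι s β →
    ΛN (π s) a b = Λ (ι s) α β

namespace IsReduction

variable {Λ : BivectorField E M} {ΛN : BivectorField EN N} {A : Set C^∞⟮𝓘(ℝ, E), M; ℝ⟯}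
  {ι : S → M} {π : S → N} (R : IsReduction Λ ΛN A ES ι π)
include R

theorem exists_descent [FiniteDimensional ℝ ES] [FiniteDimensional ℝ EN]
    [IsManifold 𝓘(ℝ, ES) ∞ S] [IsManifold 𝓘(ℝ, EN) ∞ N] {f : C^∞⟮𝓘(ℝ, E), M; ℝ⟯} (hf : f ∈ A) :
    ∃ F : C^∞⟮𝓘(ℝ, EN), N; ℝ⟯, ∀ s, F (π s) = f (ι s) :=
  exists_contMDiffMap_comp_eq R.contMDiff_right R.surjective R.submersion
    (f := fun s => f (ι s)) (f.contMDiff.comp R.contMDiff_left) (R.const f hf)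

theorem pullback_differential_eq {f : C^∞⟮𝓘(ℝ, E), M; ℝ⟯} {F : C^∞⟮𝓘(ℝ, EN), N; ℝ⟯}
    (h : ∀ s, F (π s) = f (ι s)) (s : S) :
    pullbackCotangent ES EN π s (differential F (π s)) =
      pullbackCotangent ES E ι s (differential f (ι s)) := by
  rw [pullbackCotangent_differential (F.mdifferentiable_real _)
      (R.contMDiff_right.mdifferentiable (by simp) s),
    pullbackCotangent_differential (f.mdifferentiable_real _)
      (R.contMDiff_left.mdifferentiable (by simp) s)]
  congr 1
  exact funext h

theorem poissonBracket_eq {f g : C^∞⟮𝓘(ℝ, E), M; ℝ⟯} (hf : f ∈ A) (hg : g ∈ A)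
    {F K : C^∞⟮𝓘(ℝ, EN), N; ℝ⟯} (hF : ∀ s, F (π s) = f (ι s)) (hK : ∀ s, K (π s) = g (ι s))
    (s : S) : poissonBracket ΛN F K (π s) = poissonBracket Λ f g (ι s) :=
  R.bivector s _ (differential_mem_differentialSpan hf _) _
    (differential_mem_differentialSpan hg _) _ _ (R.pullback_differential_eq hF s)
    (R.pullback_differential_eq hK s)

omit R

/-- The functions on `N` that come from the family `F` on `M`. -/
def family (ι : S → M) (π : S → N) (F : Set C^∞⟮𝓘(ℝ, E), M; ℝ⟯) : Set C^∞⟮𝓘(ℝ, EN), N; ℝ⟯ :=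
  {F' | ∃ f ∈ F, ∀ s, F' (π s) = f (ι s)}

/-- The functions on `N` that come from the algebra `F` on `M`. -/
def algebra (ι : S → M) (π : S → N) (F : Subalgebra ℝ C^∞⟮𝓘(ℝ, E), M; ℝ⟯) :
    Subalgebra ℝ C^∞⟮𝓘(ℝ, EN), N; ℝ⟯ where
  carrier := family ι π (F : Set C^∞⟮𝓘(ℝ, E), M; ℝ⟯)
  mul_mem' := by
    rintro F₁ F₂ ⟨f₁, hf₁, h₁⟩ ⟨f₂, hf₂, h₂⟩
    exact ⟨f₁ * f₂, F.mul_mem hf₁ hf₂, fun s => by simp [h₁, h₂]⟩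
  add_mem' := by
    rintro F₁ F₂ ⟨f₁, hf₁, h₁⟩ ⟨f₂, hf₂, h₂⟩
    exact ⟨f₁ + f₂, F.add_mem hf₁ hf₂, fun s => by simp [h₁, h₂]⟩
  algebraMap_mem' := fun r => ⟨algebraMap ℝ _ r, F.algebraMap_mem r, fun s => rfl⟩

omit [TopologicalSpace S] in
theorem mem_algebra {F : Subalgebra ℝ C^∞⟮𝓘(ℝ, E), M; ℝ⟯} {F' : C^∞⟮𝓘(ℝ, EN), N; ℝ⟯} :
    F' ∈ algebra ι π F ↔ ∃ f ∈ F, ∀ s, F' (π s) = f (ι s) := Iff.rfl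

include R

theorem map_differentialSpan [FiniteDimensional ℝ ES] [FiniteDimensional ℝ EN]
    [IsManifold 𝓘(ℝ, ES) ∞ S] [IsManifold 𝓘(ℝ, EN) ∞ N]
    {F : Set C^∞⟮𝓘(ℝ, E), M; ℝ⟯} (hF : F ⊆ A) (s : S) :
    (differentialSpan (E := EN) (family ι π F) (π s)).map (pullbackCotangent ES EN π s) =
      (differentialSpan F (ι s)).map (pullbackCotangent ES E ι s) := by
  rw [differentialSpan, differentialSpan, Submodule.map_span, Submodule.map_span]
  congr 1
  ext α
  constructor
  · rintro ⟨_, ⟨F', ⟨f, hf, h⟩, rfl⟩, rfl⟩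
    exact ⟨_, ⟨f, hf, rfl⟩, (R.pullback_differential_eq h s).symm⟩
  · rintro ⟨_, ⟨f, hf, rfl⟩, rfl⟩
    obtain ⟨F', h⟩ := R.exists_descent (hF hf)
    exact ⟨_, ⟨F', ⟨f, hf, h⟩, rfl⟩, R.pullback_differential_eq h s⟩

theorem map_differentialKernel [FiniteDimensional ℝ ES] [FiniteDimensional ℝ EN]
    [IsManifold 𝓘(ℝ, ES) ∞ S] [IsManifold 𝓘(ℝ, EN) ∞ N]
    {F : Set C^∞⟮𝓘(ℝ, E), M; ℝ⟯} (hF : F ⊆ A) (s : S) :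
    (differentialKernel ΛN (family ι π F) (π s)).map (pullbackCotangent ES EN π s) =
      (differentialKernel Λ F (ι s)).map (pullbackCotangent ES E ι s) :=
  map_restrictedKernel_eq (R.map_differentialSpan hF s) fun α hα β hβ =>
    R.bivector s α (differentialSpan_mono hF _ hα) β (differentialSpan_mono hF _ hβ)

theorem finrank_differentialSpan_add [FiniteDimensional ℝ E] [FiniteDimensional ℝ ES]
    [FiniteDimensional ℝ EN] [IsManifold 𝓘(ℝ, ES) ∞ S] [IsManifold 𝓘(ℝ, EN) ∞ N]
    {F : Set C^∞⟮𝓘(ℝ, E), M; ℝ⟯} (hF : F ⊆ A) {s : S}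
    (hker : LinearMap.ker (pullbackCotangent ES E ι s) ≤ differentialSpan F (ι s)) :
    finrank ℝ (differentialSpan (E := EN) (family ι π F) (π s)) +
      finrank ℝ (LinearMap.ker (pullbackCotangent ES E ι s)) =
        finrank ℝ (differentialSpan F (ι s)) := by
  rw [← finrank_map_add_finrank_of_ker_le _ hker, ← R.map_differentialSpan hF,
    finrank_map_of_injective (pullbackCotangent_injective (R.submersion s))]

theorem finrank_differentialKernel_add [FiniteDimensional ℝ E] [FiniteDimensional ℝ ES]
    [FiniteDimensional ℝ EN] [IsManifold 𝓘(ℝ, ES) ∞ S] [IsManifold 𝓘(ℝ, EN) ∞ N]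
    {F : Set C^∞⟮𝓘(ℝ, E), M; ℝ⟯} (hF : F ⊆ A) {s : S}
    (hker : LinearMap.ker (pullbackCotangent ES E ι s) ≤ differentialKernel Λ F (ι s)) :
    finrank ℝ (differentialKernel ΛN (family ι π F) (π s)) +
      finrank ℝ (LinearMap.ker (pullbackCotangent ES E ι s)) =
        finrank ℝ (differentialKernel Λ F (ι s)) := by
  rw [← finrank_map_add_finrank_of_ker_le _ hker, ← R.map_differentialKernel hF,
    finrank_map_of_injective (pullbackCotangent_injective (R.submersion s))]

theorem isOpen_dense_image [FiniteDimensional ℝ ES] [FiniteDimensional ℝ EN]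
    [IsManifold 𝓘(ℝ, ES) ∞ S] [IsManifold 𝓘(ℝ, EN) ∞ N] {U : Set M} (hU : IsOpen U)
    (hd : Dense (ι ⁻¹' U)) : IsOpen (π '' (ι ⁻¹' U)) ∧ Dense (π '' (ι ⁻¹' U)) :=
  ⟨isOpenMap_of_surjective_mfderiv R.contMDiff_right R.submersion _
      (hU.preimage R.contMDiff_left.continuous),
    R.surjective.denseRange.dense_image R.contMDiff_right.continuous hd⟩

/-- Reduction of noncommutative integrability, where `k` is the codimension of `ι`. -/
theorem isNoncommutativelyIntegrable [FiniteDimensional ℝ E] [FiniteDimensional ℝ ES]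
    [FiniteDimensional ℝ EN] [IsManifold 𝓘(ℝ, ES) ∞ S] [IsManifold 𝓘(ℝ, EN) ∞ N]
    {h : C^∞⟮𝓘(ℝ, E), M; ℝ⟯} (hh : h ∈ A) {H : C^∞⟮𝓘(ℝ, EN), N; ℝ⟯}
    (hH : ∀ s, H (π s) = h (ι s)) {F : Subalgebra ℝ C^∞⟮𝓘(ℝ, E), M; ℝ⟯}
    (hclosed : IsPoissonClosed Λ F) (hF : ∀ f ∈ F, f ∈ A ∧ IsFirstIntegral Λ h f) {l r k : ℕ}
    {U : Set M} (hU : IsOpen U) (hd : Dense (ι ⁻¹' U))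
    (hl : ∀ x ∈ U, finrank ℝ (differentialSpan (F : Set C^∞⟮𝓘(ℝ, E), M; ℝ⟯) x) = l)
    (hr : ∀ x ∈ U, finrank ℝ (differentialKernel Λ F x) = r)
    (hlr : ∀ x ∈ U, l + r = finrank ℝ E + corank Λ x)
    (hker : ∀ s, ι s ∈ U →
      LinearMap.ker (pullbackCotangent ES E ι s) ≤ differentialKernel Λ F (ι s))
    (hk : ∀ s, finrank ℝ (LinearMap.ker (pullbackCotangent ES E ι s)) = k)
    (hdim : ∀ s, finrank ℝ EN + corank ΛN (π s) + 2 * k = finrank ℝ E + corank Λ (ι s)) :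
    IsNoncommutativelyIntegrable ΛN H Set.univ := by
  have hFA : (F : Set C^∞⟮𝓘(ℝ, E), M; ℝ⟯) ⊆ A := fun f hf => (hF f hf).1
  refine ⟨algebra ι π F, ?_, ?_, ?_⟩
  · intro F₁ hF₁ F₂ hF₂
    obtain ⟨f₁, hf₁, h₁⟩ := mem_algebra.1 hF₁
    obtain ⟨f₂, hf₂, h₂⟩ := mem_algebra.1 hF₂
    obtain ⟨f₃, hf₃, h₃⟩ := hclosed f₁ hf₁ f₂ hf₂
    obtain ⟨F₃, h₄⟩ := R.exists_descent (hFA hf₃)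
    refine ⟨F₃, ⟨f₃, hf₃, h₄⟩, fun y => ?_⟩
    obtain ⟨s, rfl⟩ := R.surjective y
    rw [h₄, h₃, R.poissonBracket_eq (hFA hf₁) (hFA hf₂) h₁ h₂]
  · obtain ⟨h₁, h₂⟩ := R.isOpen_dense_image hU hd
    -- Pullback along `ι` kills a `k`-dimensional space contained in both the span and its kernel,
    -- while pullback along `π` loses nothing. So both dimensions drop by exactly `k`, and the
    -- subtractions are not truncated.
    refine ⟨l - k, r - k, _, h₁, h₂, ?_⟩
    rintro _ ⟨s, hs, rfl⟩
    have e₁ := R.finrank_differentialSpan_add hFA ((hker s hs).trans inf_le_left)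
    have e₂ := R.finrank_differentialKernel_add hFA (hker s hs)
    rw [hk, hl _ hs] at e₁
    rw [hk, hr _ hs] at e₂
    have e₃ := hlr _ hs
    have e₄ := hdim s
    refine ⟨?_, ?_, by omega⟩
    · exact Nat.eq_sub_of_add_eq e₁
    · exact Nat.eq_sub_of_add_eq e₂
  · intro F' hF'
    obtain ⟨f, hf, h'⟩ := mem_algebra.1 hF'
    refine ⟨Set.mem_univ _, fun y => ?_⟩
    obtain ⟨s, rfl⟩ := R.surjective y
    rw [R.poissonBracket_eq (hFA hf) hh h' hH]
    exact (hF f hf).2 _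

end IsReduction

end Reduction

/-! ### Generic constant linear combinations -/

section GenericCombinations

open Module Topology

/-- For density, a matrix `A` is moved along the line `A + t A₀`, where the combinations given by
`A₀` form a basis of the span. The combinations for `A + t A₀` are the images of this basis under `f
+ t`, which is invertible unless `-t` is one of the finitely many eigenvalues of `f`. -/
theorem isOpen_dense_setOf_linearIndependent_combination {V : Type*} [NormedAddCommGroup V]
    [NormedSpace ℝ V] {n m : ℕ} (v : Fin n → V)
    (hm : finrank ℝ (Submodule.span ℝ (Set.range v)) = m) :
    IsOpen {A : Fin m → Fin n → ℝ | LinearIndependent ℝ fun j => ∑ i, A j i • v i} ∧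
      Dense {A : Fin m → Fin n → ℝ | LinearIndependent ℝ fun j => ∑ i, A j i • v i} := by
  constructor
  · have hc : Continuous fun (A : Fin m → Fin n → ℝ) (j : Fin m) => ∑ i, A j i • v i := by
      fun_prop
    have ho : IsOpen {w : Fin m → V | LinearIndependent ℝ w} := isOpen_setOfPred_linearIndependent
    exact ho.preimage hc
  · intro A
    set W := Submodule.span ℝ (Set.range v) with hW
    have : FiniteDimensional ℝ W := FiniteDimensional.span_of_finite ℝ (Set.finite_range v)
    let b : Basis (Fin m) ℝ W := finBasisOfFinrankEq ℝ W hm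
    have hb : ∀ j, ∃ c : Fin n → ℝ, ∑ i, c i • v i = (b j : V) := fun j =>
      (Submodule.mem_span_range_iff_exists_fun ℝ).1 (b j).2
    choose A₀ hA₀ using hb
    let w : Fin m → W := fun j => ⟨∑ i, A j i • v i,
      (Submodule.mem_span_range_iff_exists_fun ℝ).2 ⟨A j, rfl⟩⟩
    let f : End ℝ W := b.constr ℝ w
    have hfin : {t : ℝ | f.HasEigenvalue (-t)}.Finite :=
      (End.finite_hasEigenvalue f).preimage neg_injective.injOn
    have hdense : Dense {t : ℝ | f.HasEigenvalue (-t)}ᶜ := hfin.countable.dense_compl ℝ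
    have hcont : Continuous fun t : ℝ => A + t • A₀ := by fun_prop
    have h0 : A = A + (0 : ℝ) • A₀ := by simp
    rw [h0]
    refine map_mem_closure (f := fun t : ℝ => A + t • A₀) hcont (hdense 0) fun t ht => ?_
    have hker : LinearMap.ker (f + t • (LinearMap.id : W →ₗ[ℝ] W)) = ⊥ := by
      refine LinearMap.ker_eq_bot'.2 fun x hx => ?_
      by_contra hx0
      refine ht (End.hasEigenvalue_of_hasEigenvector (x := x) ⟨?_, hx0⟩)
      rw [End.mem_eigenspace_iff, neg_smul]
      exact eq_neg_of_add_eq_zero_left hx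
    have hli := ((b.linearIndependent.map' _ hker).map' W.subtype W.ker_subtype)
    have he : (W.subtype ∘ (f + t • (LinearMap.id : W →ₗ[ℝ] W)) ∘ b) =
        fun j => ∑ i, (A + t • A₀) j i • v i := by
      funext j
      simp [f, w, add_smul, Finset.sum_add_distrib, mul_smul, ← Finset.smul_sum, hA₀]
    rw [he] at hli
    exact hli

variable {EN : Type*} [NormedAddCommGroup EN] [NormedSpace ℝ EN]
  {N : Type*} [TopologicalSpace N] [ChartedSpace EN N]

variable (EN) in
/-- The differential at a point as a linear map on smooth functions. -/
def differentialLinear (y : N) : C^∞⟮𝓘(ℝ, EN), N; ℝ⟯ →ₗ[ℝ] Cotangent EN y where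
  toFun f := differential f y
  map_add' f g := mvfderiv_add (f.mdifferentiable_real y) (g.mdifferentiable_real y)
  map_smul' c f := by
    have h := mvfderiv_smul (I := 𝓘(ℝ, EN)) (x := y) (a := fun _ => c)
      mdifferentiableAt_const (f.mdifferentiable_real y)
    have h0 : mvfderiv 𝓘(ℝ, EN) (fun _ : N => c) y = 0 := mvfderiv_const c
    rw [h0] at h
    ext v
    exact (DFunLike.congr_fun h v).trans (by simp [differential])

theorem differential_sum_smul {n : ℕ} (F : Fin n → C^∞⟮𝓘(ℝ, EN), N; ℝ⟯) (c : Fin n → ℝ) (y : N) :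
    differential (E := EN) (∑ i, c i • F i : C^∞⟮𝓘(ℝ, EN), N; ℝ⟯) y =
      ∑ i, c i • differential (E := EN) (F i) y := by
  have h := map_sum (differentialLinear EN y) (fun i => c i • F i) Finset.univ
  simp only [map_smul] at h
  exact h

theorem differentialSpan_range {n : ℕ} (F : Fin n → C^∞⟮𝓘(ℝ, EN), N; ℝ⟯) (y : N) :
    differentialSpan (E := EN) (Set.range F) y =
      Submodule.span ℝ (Set.range fun i => differential (E := EN) (F i) y) := by
  rw [differentialSpan]
  congr 1
  ext α
  constructor
  · rintro ⟨_, ⟨i, rfl⟩, rfl⟩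
    exact ⟨i, rfl⟩
  · rintro ⟨i, rfl⟩
    exact ⟨F i, ⟨i, rfl⟩, rfl⟩

/-- If the differentials of finitely many functions span spaces of dimension `m` on a dense set,
then the differentials of `m` generic constant linear combinations are independent on a dense
set. -/
theorem exists_combination_dense_linearIndependent [SecondCountableTopology N] {n m : ℕ}
    (F : Fin n → C^∞⟮𝓘(ℝ, EN), N; ℝ⟯) {D : Set N} (hD : Dense D)
    (hm : ∀ y ∈ D, finrank ℝ (differentialSpan (E := EN) (Set.range F) y) = m) :
    ∃ A : Fin m → Fin n → ℝ, Dense {y : N | LinearIndependent ℝ fun j =>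
      differential (E := EN) (∑ i, A j i • F i : C^∞⟮𝓘(ℝ, EN), N; ℝ⟯) y} := by
  let 𝓑 := TopologicalSpace.countableBasis N
  have h𝓑 : ∀ O : 𝓑, ∃ y ∈ (O : Set N), y ∈ D := fun O =>
    hD.inter_open_nonempty O (TopologicalSpace.isOpen_of_mem_countableBasis O.2)
      (TopologicalSpace.nonempty_of_mem_countableBasis O.2)
  -- One point of `D` in each basic open set is enough: independence at all of these points is
  -- independence on a dense set. It imposes countably many open dense conditions on `A`, so Baire's
  -- theorem provides a common solution.
  choose y hyO hyD using h𝓑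
  have hgood := fun O => isOpen_dense_setOf_linearIndependent_combination (V := EN →L[ℝ] ℝ)
    (fun i => differential (E := EN) (F i) (y O))
    ((congrArg (fun P : Submodule ℝ (Cotangent EN (y O)) => finrank ℝ P)
      (differentialSpan_range F (y O))).symm.trans (hm _ (hyD O)))
  have : Countable 𝓑 := TopologicalSpace.countable_countableBasis N
  obtain ⟨A, hA⟩ := (dense_iInter_of_isOpen (fun O => (hgood O).1) fun O => (hgood O).2).nonempty
  refine ⟨A, (TopologicalSpace.isBasis_countableBasis N).dense_iff.2 fun O hO _ => ?_⟩
  refine ⟨y ⟨O, hO⟩, hyO ⟨O, hO⟩, ?_⟩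
  have hA' : LinearIndependent ℝ fun j => ∑ i, A j i • differential (E := EN) (F i) (y ⟨O, hO⟩) :=
    Set.mem_iInter.1 hA ⟨O, hO⟩
  simp only [Set.mem_ofPred_eq, differential_sum_smul]
  exact hA'

end GenericCombinations

/-! ### Reduction of Liouville integrability -/

section LiouvilleReduction

open Module

variable {E : Type*} [NormedAddCommGroup E] [NormedSpace ℝ E] [FiniteDimensional ℝ E]
  {M : Type*} [TopologicalSpace M] [ChartedSpace E M]
  {ES : Type*} [NormedAddCommGroup ES] [NormedSpace ℝ ES] [FiniteDimensional ℝ ES]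
  {S : Type*} [TopologicalSpace S] [ChartedSpace ES S] [IsManifold 𝓘(ℝ, ES) ∞ S]
  {EN : Type*} [NormedAddCommGroup EN] [NormedSpace ℝ EN] [FiniteDimensional ℝ EN]
  {N : Type*} [TopologicalSpace N] [ChartedSpace EN N] [IsManifold 𝓘(ℝ, EN) ∞ N]

/-- Reduction of Liouville integrability, where `k` is the codimension of `ι`. -/
theorem IsReduction.isLiouvilleIntegrable [SecondCountableTopology N] {Λ : BivectorField E M}
    {ΛN : BivectorField EN N} {A : Set C^∞⟮𝓘(ℝ, E), M; ℝ⟯}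
    {ι : S → M} {π : S → N} (R : IsReduction Λ ΛN A ES ι π)
    {h : C^∞⟮𝓘(ℝ, E), M; ℝ⟯} (hh : h ∈ A) {H : C^∞⟮𝓘(ℝ, EN), N; ℝ⟯}
    (hH : ∀ s, H (π s) = h (ι s)) {n k : ℕ} {f : Fin n → C^∞⟮𝓘(ℝ, E), M; ℝ⟯} {U : Set M}
    (hf : IsCompleteInvolutive Λ h f U) (hfA : ∀ i, f i ∈ A) (hd : Dense (ι ⁻¹' U))
    (hker : ∀ s, ι s ∈ U →
      LinearMap.ker (pullbackCotangent ES E ι s) ≤ differentialSpan (Set.range f) (ι s))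
    (hk : ∀ s, finrank ℝ (LinearMap.ker (pullbackCotangent ES E ι s)) = k)
    (hdim : ∀ s, finrank ℝ EN + corank ΛN (π s) + 2 * k = finrank ℝ E + corank Λ (ι s)) :
    IsLiouvilleIntegrable ΛN H Set.univ := by
  choose F hF using fun i => R.exists_descent (hfA i)
  have hfam : IsReduction.family ι π (Set.range f) = Set.range F := by
    ext F'
    constructor
    · rintro ⟨_, ⟨i, rfl⟩, h'⟩
      refine ⟨i, ?_⟩
      ext y
      obtain ⟨s, rfl⟩ := R.surjective y
      rw [hF, h']
    · rintro ⟨i, rfl⟩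
      exact ⟨f i, ⟨i, rfl⟩, hF i⟩
  have hrange : Set.range f ⊆ A := Set.range_subset_iff.2 hfA
  obtain ⟨h₁, h₂⟩ := R.isOpen_dense_image hf.isOpen hd
  have hspan : ∀ s, ι s ∈ U →
      finrank ℝ (differentialSpan (E := EN) (Set.range F) (π s)) + k = n := fun s hs => by
    have e := R.finrank_differentialSpan_add hrange (hker s hs)
    rw [hk, hfam, differentialSpan_range f, finrank_span_eq_card (hf.independent _ hs),
      Fintype.card_fin] at e
    exact e
  -- The `n` descended integrals span only `n - k` dimensions. Which `n - k` of them are independent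
  -- may change from point to point, so constant combinations are taken; being constant, they still
  -- commute.
  obtain ⟨B, hB⟩ := exists_combination_dense_linearIndependent (m := n - k) F h₂ (by
    rintro _ ⟨s, hs, rfl⟩
    exact Nat.eq_sub_of_add_eq (hspan s hs))
  have hcomm : ∀ i j y, ΛN y (differential (F i) y) (differential (F j) y) = 0 := fun i j y => by
    obtain ⟨s, rfl⟩ := R.surjective y
    exact (R.poissonBracket_eq (hfA i) (hfA j) (hF i) (hF j) s).trans (hf.commute i j _)
  have hint : ∀ i y, ΛN y (differential (F i) y) (differential H y) = 0 := fun i y => by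
    obtain ⟨s, rfl⟩ := R.surjective y
    exact (R.poissonBracket_eq (hfA i) hh (hF i) hH s).trans (hf.integral i _)
  let K : Fin (n - k) → C^∞⟮𝓘(ℝ, EN), N; ℝ⟯ := fun j => ∑ i, B j i • F i
  have hK : ∀ j y, differential (E := EN) (K j) y = ∑ i, B j i • differential (E := EN) (F i) y :=
    fun j y => differential_sum_smul F (B j) y
  have ho := isOpen_setOf_linearIndependent_differential K
  refine ⟨n - k, K, {y | LinearIndependent ℝ fun j => differential (E := EN) (K j) y} ∩
    π '' (ι ⁻¹' U), ⟨fun i j y => ?_, fun i y => ?_, ho.inter h₁, hB.inter_of_isOpen_left h₂ ho,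
      fun y hy => hy.1, ?_⟩, fun _ => Set.mem_univ _⟩
  · simp [poissonBracket, hK, hcomm]
  · simp [poissonBracket, hK, hint]
  · rintro _ ⟨-, s, hs, rfl⟩
    have e₁ := hspan s hs
    have e₂ := hdim s
    have e₃ := hf.card _ hs
    omega

end LiouvilleReduction

/-! ### The span of the moment differentials and its orthogonal -/

section MomentSpan

open Module

variable {EG : Type*} [NormedAddCommGroup EG] [NormedSpace ℝ EG]
  {G : Type*} [TopologicalSpace G] [ChartedSpace EG G] [Group G]
  {E : Type*} [NormedAddCommGroup E] [NormedSpace ℝ E]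
  {M : Type*} [TopologicalSpace M] [ChartedSpace E M] [IsManifold 𝓘(ℝ, E) ∞ M]
  [MulAction G M] {Ω : SymplecticForm E M} {Φ : M → LieDual EG G}

/-- The linear map `ξ ↦ φ_ξ`. -/
def momentFunction (hΦ : IsHamiltonianAction Ω Φ) :
    GroupLieAlgebra 𝓘(ℝ, EG) G →ₗ[ℝ] C^∞⟮𝓘(ℝ, E), M; ℝ⟯ where
  toFun ξ := ⟨fun y => Φ y ξ, hΦ.smooth ξ⟩
  map_add' ξ ζ := by
    ext y
    exact map_add (Φ y) ξ ζ
  map_smul' c ξ := by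
    ext y
    exact map_smul (Φ y) c ξ

/-- The linear map `ξ ↦ d(φ_ξ)_x`. -/
def momentDifferential (hΦ : IsHamiltonianAction Ω Φ) (x : M) :
    GroupLieAlgebra 𝓘(ℝ, EG) G →ₗ[ℝ] Cotangent E x :=
  (differentialLinear E x).comp (momentFunction hΦ)

theorem momentDifferential_apply (hΦ : IsHamiltonianAction Ω Φ) (x : M)
    (ξ : GroupLieAlgebra 𝓘(ℝ, EG) G) :
    momentDifferential hΦ x ξ = differential (fun y => Φ y ξ) x := rfl

/-- The span of the differentials of the components of the moment map. -/
def momentSpan (hΦ : IsHamiltonianAction Ω Φ) (x : M) : Submodule ℝ (Cotangent E x) :=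
  LinearMap.range (momentDifferential hΦ x)

theorem differential_mem_momentSpan (hΦ : IsHamiltonianAction Ω Φ) (x : M)
    (ξ : GroupLieAlgebra 𝓘(ℝ, EG) G) : differential (fun y => Φ y ξ) x ∈ momentSpan hΦ x :=
  ⟨ξ, rfl⟩

theorem mem_orthogonal_momentSpan_iff (hΦ : IsHamiltonianAction Ω Φ) {x : M} {α : Cotangent E x} :
    α ∈ (Ω.bivector x).orthogonal (momentSpan hΦ x) ↔
      ∀ ξ : GroupLieAlgebra 𝓘(ℝ, EG) G, differential (fun y => Φ y ξ) x (Ω.sharp x α) = 0 := by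
  rw [LinearMap.BilinForm.mem_orthogonal_iff]
  constructor
  · exact fun h ξ => h _ (differential_mem_momentSpan hΦ x ξ)
  · rintro h _ ⟨ξ, rfl⟩
    exact h ξ

theorem differentialSpan_invariantFunctions_le [ContMDiffSMul 𝓘(ℝ, EG) 𝓘(ℝ, E) ∞ G M]
    (hΦ : IsHamiltonianAction Ω Φ) (x : M) :
    differentialSpan (invariantFunctions G E M) x ≤
      (Ω.bivector x).orthogonal (momentSpan hΦ x) := by
  refine Submodule.span_le.2 ?_
  rintro _ ⟨f, hf, rfl⟩
  refine (mem_orthogonal_momentSpan_iff hΦ).2 fun ξ => ?_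
  have h := differential_hamiltonianField_of_invariant hΦ f.mdifferentiable_real hf x ξ
  exact (Ω.bivector_isRefl x) (differential f x) (differential (fun y => Φ y ξ) x) h

/-- The heart of (i). With `F` the span of the differentials and `P` the moment span, invariance
gives `P ≤ F^⊥` and completeness gives `F^⊥ ≤ F`, so `P ≤ F ∩ F^⊥`. -/
theorem momentSpan_le_differentialKernel [FiniteDimensional ℝ E]
    [ContMDiffSMul 𝓘(ℝ, EG) 𝓘(ℝ, E) ∞ G M]
    (hΦ : IsHamiltonianAction Ω Φ) {F : Set C^∞⟮𝓘(ℝ, E), M; ℝ⟯}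
    (hF : F ⊆ invariantFunctions G E M) {x : M}
    (h : finrank ℝ (differentialSpan F x) + finrank ℝ (differentialKernel Ω.bivector F x) =
      finrank ℝ E) :
    momentSpan hΦ x ≤ differentialKernel Ω.bivector F x := by
  have h₁ : (Ω.bivector x).orthogonal (differentialSpan F x) ≤ differentialSpan F x :=
    orthogonal_le_of_finrank_add_finrank_eq (Ω.bivector_isRefl x) (Ω.bivector_nondegenerate x)
      (h.trans (finrank_cotangent x).symm)
  have h₂ : momentSpan hΦ x ≤ (Ω.bivector x).orthogonal (differentialSpan F x) := fun α hα =>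
    LinearMap.BilinForm.mem_orthogonal_iff.2 fun β hβ => Ω.bivector_isRefl x _ _
      (LinearMap.BilinForm.mem_orthogonal_iff.1
        (differentialSpan_invariantFunctions_le hΦ x (differentialSpan_mono hF x hβ)) α hα)
  have h₃ := restrictedKernel_eq_inf_orthogonal (Ω.bivector_isRefl x) (differentialSpan F x)
  exact (le_inf (h₂.trans h₁) h₂).trans h₃.ge

theorem poissonBracket_moment_eq_zero_of_complete [FiniteDimensional ℝ E]
    [ContMDiffSMul 𝓘(ℝ, EG) 𝓘(ℝ, E) ∞ G M]
    (hΦ : IsHamiltonianAction Ω Φ) {F : Set C^∞⟮𝓘(ℝ, E), M; ℝ⟯}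
    (hF : F ⊆ invariantFunctions G E M) {U : Set M} (hU : Dense U)
    (h : ∀ x ∈ U, finrank ℝ (differentialSpan F x) +
      finrank ℝ (differentialKernel Ω.bivector F x) = finrank ℝ E)
    (ξ ζ : GroupLieAlgebra 𝓘(ℝ, EG) G) (x : M) :
    poissonBracket Ω.bivector (fun y => Φ y ξ) (fun y => Φ y ζ) x = 0 := by
  refine poissonBracket_moment_eq_zero_of_dense hΦ hU (fun x hx ξ ζ => ?_) ξ ζ x
  have h₁ := momentSpan_le_differentialKernel hΦ hF (h x hx)
  exact (mem_restrictedKernel.1 (h₁ (differential_mem_momentSpan hΦ x ξ))).2 _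
    (mem_restrictedKernel.1 (h₁ (differential_mem_momentSpan hΦ x ζ))).1

theorem momentSpan_le_orthogonal (hΦ : IsHamiltonianAction Ω Φ) {x : M}
    (hcomm : ∀ ξ ζ : GroupLieAlgebra 𝓘(ℝ, EG) G,
      poissonBracket Ω.bivector (fun y => Φ y ξ) (fun y => Φ y ζ) x = 0) :
    momentSpan hΦ x ≤ (Ω.bivector x).orthogonal (momentSpan hΦ x) := by
  rintro _ ⟨ζ, rfl⟩
  exact (mem_orthogonal_momentSpan_iff hΦ).2 fun ξ => hcomm ξ ζ

/-- A zero of `dφ_ξ` is a zero of the generator `X_{φ_ξ}`, and a free action has none unless `ξ =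
0`. -/
theorem momentDifferential_injective [FiniteDimensional ℝ EG] [LieGroup 𝓘(ℝ, EG) ∞ G]
    [ContMDiffSMul 𝓘(ℝ, EG) 𝓘(ℝ, E) ∞ G M] (hΦ : IsHamiltonianAction Ω Φ)
    (hfree : ∀ (g : G) (x : M), g • x = x → g = 1) (x : M) :
    Function.Injective (momentDifferential hΦ x) := by
  refine (injective_iff_map_eq_zero _).2 fun ξ hξ => ?_
  refine orbitMap_mfderiv_injective (E := E) hfree x ξ ?_
  rw [hΦ.generator, SymplecticForm.hamiltonianField, ← momentDifferential_apply hΦ, hξ]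
  exact map_zero _

theorem finrank_momentSpan [FiniteDimensional ℝ EG] [LieGroup 𝓘(ℝ, EG) ∞ G]
    [ContMDiffSMul 𝓘(ℝ, EG) 𝓘(ℝ, E) ∞ G M] (hΦ : IsHamiltonianAction Ω Φ)
    (hfree : ∀ (g : G) (x : M), g • x = x → g = 1) (x : M) :
    finrank ℝ (momentSpan hΦ x) = finrank ℝ EG :=
  LinearMap.finrank_range_of_inj (momentDifferential_injective hΦ hfree x)

theorem finrank_orthogonal_momentSpan [FiniteDimensional ℝ E] [FiniteDimensional ℝ EG]
    [LieGroup 𝓘(ℝ, EG) ∞ G] [ContMDiffSMul 𝓘(ℝ, EG) 𝓘(ℝ, E) ∞ G M]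
    (hΦ : IsHamiltonianAction Ω Φ) (hfree : ∀ (g : G) (x : M), g • x = x → g = 1) (x : M) :
    finrank ℝ ((Ω.bivector x).orthogonal (momentSpan hΦ x)) = finrank ℝ E - finrank ℝ EG := by
  rw [LinearMap.BilinForm.finrank_orthogonal (Ω.bivector_nondegenerate x), finrank_cotangent,
    finrank_momentSpan hΦ hfree]

theorem orthogonal_orthogonal_momentSpan [FiniteDimensional ℝ E]
    (hΦ : IsHamiltonianAction Ω Φ) (x : M) :
    (Ω.bivector x).orthogonal ((Ω.bivector x).orthogonal (momentSpan hΦ x)) = momentSpan hΦ x :=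
  LinearMap.BilinForm.orthogonal_orthogonal (Ω.bivector_nondegenerate x) (Ω.bivector_isRefl x) _

/-- The derivative of `Φ` is the transpose of the injective map `ξ ↦ dφ_ξ`. -/
theorem surjective_differential_moment [FiniteDimensional ℝ E] [FiniteDimensional ℝ EG]
    [LieGroup 𝓘(ℝ, EG) ∞ G] [ContMDiffSMul 𝓘(ℝ, EG) 𝓘(ℝ, E) ∞ G M]
    (hΦ : IsHamiltonianAction Ω Φ) (hfree : ∀ (g : G) (x : M), g • x = x → g = 1) (x : M)
    (η : LieDual EG G) : ∃ v : TangentSpace 𝓘(ℝ, E) x,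
      ∀ ξ, differential (fun y => Φ y ξ) x v = η ξ := by
  obtain ⟨L, hL⟩ := (momentDifferential hΦ x).exists_leftInverse_of_injective
    (LinearMap.ker_eq_bot.2 (momentDifferential_injective hΦ hfree x))
  -- The functional `η ∘ L` on covectors is represented as `Λ(γ, ·)`. Skew-symmetry then accounts
  -- for the sign in the vector `-Ω.sharp x γ`.
  let γ := ((Ω.bivector x).toDual (Ω.bivector_nondegenerate x)).symm
    ((η : GroupLieAlgebra 𝓘(ℝ, EG) G →ₗ[ℝ] ℝ).comp L)
  refine ⟨-Ω.sharp x γ, fun ξ => ?_⟩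
  have h₁ : Ω.bivector x γ (momentDifferential hΦ x ξ) = η (L (momentDifferential hΦ x ξ)) :=
    LinearMap.BilinForm.apply_toDual_symm_apply _ _
  have h₂ : L (momentDifferential hΦ x ξ) = ξ := LinearMap.congr_fun hL ξ
  rw [h₂, Ω.bivector_swap] at h₁
  rw [map_neg]
  exact h₁

end MomentSpan

/-! ### Involutive families as complete families -/

section Involutive

open Module

variable {E : Type*} [NormedAddCommGroup E] [NormedSpace ℝ E]
  {M : Type*} [TopologicalSpace M] [ChartedSpace E M]

theorem IsCompleteInvolutive.differentialKernel_eq {Λ : BivectorField E M} {h : M → ℝ} {n : ℕ}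
    {f : Fin n → C^∞⟮𝓘(ℝ, E), M; ℝ⟯} {U : Set M} (hf : IsCompleteInvolutive Λ h f U) (x : M) :
    differentialKernel Λ (Set.range f) x = differentialSpan (Set.range f) x := by
  refine le_antisymm inf_le_left fun α hα => mem_restrictedKernel.2 ⟨hα, fun β hβ => ?_⟩
  rw [differentialSpan_range] at hα hβ
  have h₁ : ∀ i, ∀ β ∈ Submodule.span ℝ (Set.range fun i => differential (E := E) (f i) x),
      Λ x (differential (f i) x) β = 0 := fun i β hβ => by
    have : Submodule.span ℝ (Set.range fun i => differential (E := E) (f i) x) ≤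
        LinearMap.ker (Λ x (differential (f i) x)) := by
      refine Submodule.span_le.2 ?_
      rintro _ ⟨j, rfl⟩
      exact hf.commute i j x
    exact this hβ
  have h₂ : Submodule.span ℝ (Set.range fun i => differential (E := E) (f i) x) ≤
      LinearMap.ker ((Λ x).flip β) := by
    refine Submodule.span_le.2 ?_
    rintro _ ⟨i, rfl⟩
    exact h₁ i β hβ
  exact h₂ hα

/-- A commuting family is its own kernel, so it satisfies the completeness equation with `l = r =
n`. This lets the arguments for complete families cover the Liouville case. -/
theorem IsCompleteInvolutive.finrank_add [FiniteDimensional ℝ E] {Λ : BivectorField E M}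
    {h : M → ℝ} {n : ℕ} {f : Fin n → C^∞⟮𝓘(ℝ, E), M; ℝ⟯} {U : Set M}
    (hf : IsCompleteInvolutive Λ h f U) {x : M} (hx : x ∈ U) :
    finrank ℝ (differentialSpan (E := E) (Set.range f) x) +
      finrank ℝ (differentialKernel Λ (Set.range f) x) = finrank ℝ E + corank Λ x := by
  rw [hf.differentialKernel_eq, differentialSpan_range,
    finrank_span_eq_card (hf.independent x hx), Fintype.card_fin, ← hf.card x hx, two_mul]

end Involutive

/-! ### Generic fibres of open maps -/

section GenericFibres

open Filter Topology

/-- For a continuous open map and an open dense set `U`, a generic fibre meets `U` densely. -/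
theorem eventually_residual_dense_fibre {X Y : Type*} [TopologicalSpace X] [TopologicalSpace Y]
    [SecondCountableTopology X] {f : X → Y} (hf : Continuous f) (ho : IsOpenMap f) {U : Set X}
    (hU : IsOpen U) (hd : Dense U) :
    ∀ᶠ y in residual Y, ∀ x, f x = y → ∀ O ∈ 𝓝 x, ∃ x' ∈ O ∩ U, f x' = y := by
  -- The images `f '' (O ∩ U)` are open, and the frontier of an open set is closed with empty
  -- interior; generic values avoid countably many such frontiers.
  have h₁ : ∀ᶠ y in residual Y, ∀ O ∈ TopologicalSpace.countableBasis X,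
      y ∉ frontier (f '' (O ∩ U)) := by
    refine (eventually_countable_ball (TopologicalSpace.countable_countableBasis X)).2
      fun O hO => ?_
    have hO' := TopologicalSpace.isOpen_of_mem_countableBasis hO
    exact residual_of_dense_open isClosed_frontier.isOpen_compl
      (interior_eq_empty_iff_dense_compl.1 (by
        rw [← frontier_compl]
        exact interior_frontier (ho _ (hO'.inter hU)).isClosed_compl))
  filter_upwards [h₁] with y hy x hx O hO
  obtain ⟨B, hB, hxB, hBO⟩ := (TopologicalSpace.isBasis_countableBasis X).mem_nhds_iff.1 hO
  have hBo := TopologicalSpace.isOpen_of_mem_countableBasis hB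
  -- Density of `U` puts `y` in the closure of the image; a point of the closure that is not on the
  -- frontier of an open set belongs to the set.
  have hcl : y ∈ closure (f '' (B ∩ U)) := by
    rw [← hx]
    refine image_closure_subset_closure_image hf ⟨x, ?_, rfl⟩
    exact hd.open_subset_closure_inter hBo hxB
  have hmem : y ∈ f '' (B ∩ U) := by
    by_contra hne
    refine hy B hB ?_
    rw [(ho _ (hBo.inter hU)).frontier_eq]
    exact ⟨hcl, hne⟩
  obtain ⟨x', hx', e⟩ := hmem
  exact ⟨x', ⟨hBO hx'.1, hx'.2⟩, e⟩

end GenericFibres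

/-! ### The Poisson manifold `M / G` -/

section OrbitManifold

open Module

variable {EG : Type*} [NormedAddCommGroup EG] [NormedSpace ℝ EG] [FiniteDimensional ℝ EG]
  {G : Type*} [TopologicalSpace G] [ChartedSpace EG G] [Group G] [LieGroup 𝓘(ℝ, EG) ∞ G]
  {E : Type*} [NormedAddCommGroup E] [NormedSpace ℝ E] [FiniteDimensional ℝ E]
  {M : Type*} [TopologicalSpace M] [ChartedSpace E M] [IsManifold 𝓘(ℝ, E) ∞ M]
  [MulAction G M] [ContMDiffSMul 𝓘(ℝ, EG) 𝓘(ℝ, E) ∞ G M]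
  {Ω : SymplecticForm E M} {Φ : M → LieDual EG G}
  {EB : Type*} [NormedAddCommGroup EB] [NormedSpace ℝ EB] [FiniteDimensional ℝ EB]
  {B : Type*} [TopologicalSpace B] [ChartedSpace EB B] [IsManifold 𝓘(ℝ, EB) ∞ B] [T2Space B]
  {p : M → B} {ΛB : BivectorField EB B}

theorem pullbackCotangent_id (x : M) (α : Cotangent E x) :
    pullbackCotangent E E (id : M → M) x α = α := by
  ext v
  rw [pullbackCotangent_apply, mfderiv_id]
  rfl

theorem ker_pullbackCotangent_id (x : M) :
    LinearMap.ker (pullbackCotangent E E (id : M → M) x) = ⊥ :=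
  LinearMap.ker_eq_bot'.2 fun α hα => (pullbackCotangent_id x α).symm.trans hα

/-- The reduced bracket is prescribed on functions only; it determines `ΛB` on covectors because
each covector is the differential of a global smooth function. -/
theorem IsOrbitManifold.bivector_eq (hp : IsOrbitManifold (E := E) (EB := EB) EG G p)
    (hΛ : IsReducedPoisson Ω p ΛB) (x : M) (a b : Cotangent EB (p x)) :
    ΛB (p x) a b =
      Ω.bivector x (pullbackCotangent E EB p x a) (pullbackCotangent E EB p x b) := by
  obtain ⟨F₁, rfl⟩ := exists_differential_eq (p x) a
  obtain ⟨F₂, rfl⟩ := exists_differential_eq (p x) b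
  have hpx := hp.contMDiff.mdifferentiable (by simp) x
  rw [pullbackCotangent_differential (F₁.mdifferentiable_real _) hpx,
    pullbackCotangent_differential (F₂.mdifferentiable_real _) hpx]
  exact hΛ F₁ F₂ x

theorem IsOrbitManifold.isReduction (hp : IsOrbitManifold (E := E) (EB := EB) EG G p)
    (hΛ : IsReducedPoisson Ω p ΛB) :
    IsReduction Ω.bivector ΛB (invariantFunctions G E M) E id p where
  contMDiff_left := contMDiff_id
  contMDiff_right := hp.contMDiff
  surjective := hp.surjective
  submersion := hp.submersion
  const f hf x y hxy := by
    obtain ⟨g, rfl⟩ := (hp.fibre x y).1 hxy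
    exact (hf g x).symm
  bivector x α _ β _ a b ha hb := by
    rw [hp.bivector_eq hΛ]
    have ha' := ha.trans (pullbackCotangent_id x α)
    have hb' := hb.trans (pullbackCotangent_id x β)
    exact congrArg₂ (fun α β => Ω.bivector x α β) ha' hb'

/-- Functions pulled back from `B` are invariant, which gives one inclusion; both sides have
dimension `dim M - dim G`. -/
theorem IsOrbitManifold.range_pullbackCotangent
    (hp : IsOrbitManifold (E := E) (EB := EB) EG G p) (hΦ : IsHamiltonianAction Ω Φ)
    (hfree : ∀ (g : G) (x : M), g • x = x → g = 1) (x : M) :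
    LinearMap.range (pullbackCotangent E EB p x) =
      (Ω.bivector x).orthogonal (momentSpan hΦ x) := by
  have hinj := pullbackCotangent_injective (hp.submersion x)
  refine Submodule.eq_of_le_of_finrank_eq ?_ ?_
  · rintro _ ⟨b, rfl⟩
    obtain ⟨F, rfl⟩ := exists_differential_eq (p x) b
    rw [pullbackCotangent_differential (F.mdifferentiable_real _)
      (hp.contMDiff.mdifferentiable (by simp) x)]
    have hmem : (⟨fun y => F (p y), F.contMDiff.comp hp.contMDiff⟩ : C^∞⟮𝓘(ℝ, E), M; ℝ⟯) ∈
        invariantFunctions G E M := fun g y =>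
      congrArg F ((hp.fibre y (g • y)).2 ⟨g, rfl⟩).symm
    exact differentialSpan_invariantFunctions_le hΦ x (differential_mem_differentialSpan hmem x)
  · have h := hp.finrank_add
    rw [LinearMap.finrank_range_of_inj hinj, finrank_cotangent,
      finrank_orthogonal_momentSpan hΦ hfree]
    omega

/-- Pullback identifies `ΛB` with the restriction of `Λ` to `P^⊥`, where `P` is the moment span. The
kernel of this restriction is `P^⊥ ∩ P^⊥⊥ = P^⊥ ∩ P`, which equals `P` because commuting moments
make `P` isotropic. -/
theorem IsOrbitManifold.corank_eq (hp : IsOrbitManifold (E := E) (EB := EB) EG G p)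
    (hΛ : IsReducedPoisson Ω p ΛB) (hΦ : IsHamiltonianAction Ω Φ)
    (hfree : ∀ (g : G) (x : M), g • x = x → g = 1) (x : M)
    (hcomm : ∀ ξ ζ : GroupLieAlgebra 𝓘(ℝ, EG) G,
      poissonBracket Ω.bivector (fun y => Φ y ξ) (fun y => Φ y ζ) x = 0) :
    corank ΛB (p x) = finrank ℝ EG := by
  have hrange := hp.range_pullbackCotangent hΦ hfree x
  have hmap : (LinearMap.ker (ΛB (p x))).map (pullbackCotangent E EB p x) = momentSpan hΦ x := by
    refine le_antisymm ?_ fun α hα => ?_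
    · rintro _ ⟨a, ha, rfl⟩
      rw [← orthogonal_orthogonal_momentSpan hΦ x, LinearMap.BilinForm.mem_orthogonal_iff, ← hrange]
      rintro _ ⟨b, rfl⟩
      refine Ω.bivector_isRefl x _ _ ?_
      rw [← hp.bivector_eq hΛ, LinearMap.mem_ker.1 ha, LinearMap.zero_apply]
    · obtain ⟨a, rfl⟩ : α ∈ LinearMap.range (pullbackCotangent E EB p x) := by
        rw [hrange]
        exact momentSpan_le_orthogonal hΦ hcomm hα
      refine ⟨a, LinearMap.mem_ker.2 (LinearMap.ext fun b => ?_), rfl⟩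
      rw [hp.bivector_eq hΛ]
      have hb : pullbackCotangent E EB p x b ∈
          (Ω.bivector x).orthogonal (momentSpan hΦ x) := hrange ▸ LinearMap.mem_range_self _ b
      exact LinearMap.BilinForm.mem_orthogonal_iff.1 hb _ hα
  rw [corank, ← finrank_map_of_injective (pullbackCotangent_injective (hp.submersion x)), hmap,
    finrank_momentSpan hΦ hfree]

end OrbitManifold

/-! ### Openness of maps into a dual space -/

section DualValued

open Module

theorem isOpenMap_of_surjective_differential
    {V : Type*} [NormedAddCommGroup V] [NormedSpace ℝ V] [FiniteDimensional ℝ V]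
    {E : Type*} [NormedAddCommGroup E] [NormedSpace ℝ E] [FiniteDimensional ℝ E]
    {M : Type*} [TopologicalSpace M] [ChartedSpace E M] [IsManifold 𝓘(ℝ, E) ∞ M]
    {Ψ : M → V →L[ℝ] ℝ} (hsmooth : ∀ ξ, ContMDiff 𝓘(ℝ, E) 𝓘(ℝ, ℝ) ∞ (fun x => Ψ x ξ))
    (hsurj : ∀ (x : M) (η : V →L[ℝ] ℝ), ∃ v : TangentSpace 𝓘(ℝ, E) x,
      ∀ ξ, differential (fun y => Ψ y ξ) x v = η ξ) : Continuous Ψ ∧ IsOpenMap Ψ := by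
  let b := finBasis ℝ V
  -- Smoothness is assumed for each component only; the coordinates in a basis of `V` turn it into
  -- smoothness of `Ψ`.
  let T : (V →L[ℝ] ℝ) ≃L[ℝ] (Fin (finrank ℝ V) → ℝ) :=
    (LinearMap.toContinuousLinearMap.symm.trans (b.constr ℝ).symm).toContinuousLinearEquiv
  have hTΨ : ContMDiff 𝓘(ℝ, E) 𝓘(ℝ, Fin (finrank ℝ V) → ℝ) ∞ (fun x => T (Ψ x)) :=
    contMDiff_pi_space.2 fun j => hsmooth (b j)
  have hΨ : ContMDiff 𝓘(ℝ, E) 𝓘(ℝ, V →L[ℝ] ℝ) ∞ Ψ :=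
    (T.symm.contDiff.contMDiff.comp hTΨ).congr fun x => (T.symm_apply_apply (Ψ x)).symm
  refine ⟨hΨ.continuous, isOpenMap_of_surjective_mfderiv hΨ fun x (η : V →L[ℝ] ℝ) => ?_⟩
  obtain ⟨v, hv⟩ := hsurj x η
  let w : V →L[ℝ] ℝ := mfderiv 𝓘(ℝ, E) 𝓘(ℝ, V →L[ℝ] ℝ) Ψ x v
  have hw : w = η := by
    ext ξ
    let ev : (V →L[ℝ] ℝ) →L[ℝ] ℝ := ContinuousLinearMap.apply ℝ ℝ ξ
    have h := mfderiv_comp_apply x (ev.hasMFDerivAt (x := Ψ x)).mdifferentiableAt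
      (hΨ.mdifferentiable (by simp) x) v
    rw [(ev.hasMFDerivAt (x := Ψ x)).mfderiv] at h
    exact h.symm.trans (hv ξ)
  exact ⟨v, hw⟩

end DualValued

/-! ### The reduced symplectic manifold `N_η` -/

section ReducedSpace

open Module

variable {EG : Type*} [NormedAddCommGroup EG] [NormedSpace ℝ EG] [FiniteDimensional ℝ EG]
  {G : Type*} [TopologicalSpace G] [ChartedSpace EG G] [Group G] [LieGroup 𝓘(ℝ, EG) ∞ G]
  {E : Type*} [NormedAddCommGroup E] [NormedSpace ℝ E] [FiniteDimensional ℝ E]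
  {M : Type*} [TopologicalSpace M] [ChartedSpace E M] [IsManifold 𝓘(ℝ, E) ∞ M]
  [MulAction G M] [ContMDiffSMul 𝓘(ℝ, EG) 𝓘(ℝ, E) ∞ G M]
  {Ω : SymplecticForm E M} {Φ : M → LieDual EG G} {η : LieDual EG G}
  {ES : Type*} [NormedAddCommGroup ES] [NormedSpace ℝ ES] [FiniteDimensional ℝ ES]
  {S : Type*} [TopologicalSpace S] [ChartedSpace ES S]
  {EN : Type*} [NormedAddCommGroup EN] [NormedSpace ℝ EN] [FiniteDimensional ℝ EN]
  {N : Type*} [TopologicalSpace N] [ChartedSpace EN N] [IsManifold 𝓘(ℝ, EN) ∞ N]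
  {ι : S → M} {π : S → N} {ΩN : SymplecticForm EN N}

/-- The components of `Φ` are constant on the level, so its tangent space lies in the kernel of the
derivative of `Φ`; the codimension `dim G` makes this an equality. -/
theorem IsMomentLevel.range_mfderiv (hι : IsMomentLevel (E := E) (ES := ES) Φ η ι)
    (hΦ : IsHamiltonianAction Ω Φ) (hfree : ∀ (g : G) (x : M), g • x = x → g = 1) (s : S) :
    LinearMap.range (mfderiv 𝓘(ℝ, ES) 𝓘(ℝ, E) ι s : TangentSpace 𝓘(ℝ, ES) s →ₗ[ℝ] _) =
      ((Ω.bivector (ι s)).orthogonal (momentSpan hΦ (ι s))).map (Ω.sharp (ι s)) := by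
  refine Submodule.eq_of_le_of_finrank_eq ?_ ?_
  · rintro _ ⟨u, rfl⟩
    obtain ⟨α, hα⟩ := Ω.sharp_surjective (ι s) (mfderiv 𝓘(ℝ, ES) 𝓘(ℝ, E) ι s u)
    refine ⟨α, (mem_orthogonal_momentSpan_iff hΦ).2 fun ξ => ?_, hα⟩
    rw [hα, ← differential_comp (hΦ.mdifferentiable ξ _)
      (hι.contMDiff.mdifferentiable (by simp) s)]
    have hconst : (fun t => Φ (ι t) ξ) = fun _ => η ξ := funext fun t => by
      have : ι t ∈ {x | Φ x = η} := hι.range_eq ▸ Set.mem_range_self t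
      exact congrArg (fun θ : LieDual EG G => θ ξ) this
    rw [hconst, differential, mvfderiv_const]
    rfl
  · have h := hι.finrank_add
    rw [finrank_map_of_injective (Ω.sharp_injective _), finrank_orthogonal_momentSpan hΦ hfree]
    refine (LinearMap.finrank_range_of_inj (hι.immersion s)).trans ?_
    change finrank ℝ ES = _
    omega

/-- The kernel is the annihilator of the tangent space of the level, which by `range_mfderiv` is the
double orthogonal of the moment span. -/
theorem IsMomentLevel.ker_pullbackCotangent (hι : IsMomentLevel (E := E) (ES := ES) Φ η ι)
    (hΦ : IsHamiltonianAction Ω Φ) (hfree : ∀ (g : G) (x : M), g • x = x → g = 1) (s : S) :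
    LinearMap.ker (pullbackCotangent ES E ι s) = momentSpan hΦ (ι s) := by
  have hrange := hι.range_mfderiv hΦ hfree s
  ext α
  rw [← orthogonal_orthogonal_momentSpan hΦ (ι s), LinearMap.BilinForm.mem_orthogonal_iff]
  constructor
  · intro hα β hβ
    refine Ω.bivector_isRefl _ _ _ ?_
    obtain ⟨u, hu⟩ : Ω.sharp (ι s) β ∈ LinearMap.range
        (mfderiv 𝓘(ℝ, ES) 𝓘(ℝ, E) ι s : TangentSpace 𝓘(ℝ, ES) s →ₗ[ℝ] _) := by
      rw [hrange]
      exact Submodule.mem_map_of_mem hβ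
    rw [Ω.bivector_apply, ← hu]
    exact DFunLike.congr_fun (LinearMap.mem_ker.1 hα) u
  · intro h
    refine LinearMap.mem_ker.2 ?_
    ext u
    obtain ⟨β, hβ, hu⟩ : mfderiv 𝓘(ℝ, ES) 𝓘(ℝ, E) ι s u ∈
        ((Ω.bivector (ι s)).orthogonal (momentSpan hΦ (ι s))).map (Ω.sharp (ι s)) := by
      rw [← hrange]
      exact ⟨u, rfl⟩
    rw [pullbackCotangent_apply, ← hu]
    exact Ω.bivector_isRefl _ _ _ (h β hβ)

/-- Hamiltonian vectors tangent to the level project to Hamiltonian vectors: both sides pair equally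
with every projected vector, since the two forms have the same pullback to `S`. -/
theorem IsReducedSpace.mfderiv_eq_sharp (hπ : IsReducedSpace (E := E) (ES := ES) Ω η ι π ΩN)
    {s : S} {u : TangentSpace 𝓘(ℝ, ES) s} {β : Cotangent E (ι s)} {b : Cotangent EN (π s)}
    (hu : mfderiv 𝓘(ℝ, ES) 𝓘(ℝ, E) ι s u = Ω.sharp (ι s) β)
    (hb : pullbackCotangent ES EN π s b = pullbackCotangent ES E ι s β) :
    mfderiv 𝓘(ℝ, ES) 𝓘(ℝ, EN) π s u = ΩN.sharp (π s) b := by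
  refine ΩN.eq_of_form_eq fun w' => ?_
  obtain ⟨w, rfl⟩ := hπ.submersion s w'
  rw [hπ.pullback, hu, Ω.form_sharp, ΩN.form_sharp]
  exact (DFunLike.congr_fun hb w).symm

theorem IsReducedSpace.isReduction (hπ : IsReducedSpace (E := E) (ES := ES) Ω η ι π ΩN)
    (hι : IsMomentLevel (E := E) (ES := ES) Φ η ι)
    (hΦ : IsHamiltonianAction Ω Φ) (hfree : ∀ (g : G) (x : M), g • x = x → g = 1) :
    IsReduction Ω.bivector ΩN.bivector (invariantFunctions G E M) ES ι π where
  contMDiff_left := hι.contMDiff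
  contMDiff_right := hπ.contMDiff
  surjective := hπ.surjective
  submersion := hπ.submersion
  const f hf s t hst := by
    obtain ⟨g, -, h⟩ := (hπ.fibre s t).1 hst
    rw [← h, hf]
  bivector s α _ β hβ a b ha hb := by
    -- Covectors of invariant functions have Hamiltonian vectors tangent to the level, so the
    -- bracket can be computed upstairs on `S`.
    obtain ⟨u, hu⟩ : Ω.sharp (ι s) β ∈ LinearMap.range
        (mfderiv 𝓘(ℝ, ES) 𝓘(ℝ, E) ι s : TangentSpace 𝓘(ℝ, ES) s →ₗ[ℝ] _) := by
      rw [hι.range_mfderiv hΦ hfree s]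
      exact Submodule.mem_map_of_mem (differentialSpan_invariantFunctions_le hΦ _ hβ)
    rw [ΩN.bivector_apply, Ω.bivector_apply, ← hπ.mfderiv_eq_sharp hu hb, ← hu]
    exact DFunLike.congr_fun ha u

/-- Nondegeneracy of `ΩN` makes the kernel of the derivative of `π` the radical of the form pulled
back to the level. Since the moment span is isotropic, this radical is its image under `sharp`, of
dimension `dim G`. The group `G_η` itself need not be known. -/
theorem IsReducedSpace.finrank_add (hπ : IsReducedSpace (E := E) (ES := ES) Ω η ι π ΩN)
    (hι : IsMomentLevel (E := E) (ES := ES) Φ η ι)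
    (hΦ : IsHamiltonianAction Ω Φ) (hfree : ∀ (g : G) (x : M), g • x = x → g = 1) (s : S)
    (hcomm : ∀ ξ ζ : GroupLieAlgebra 𝓘(ℝ, EG) G,
      poissonBracket Ω.bivector (fun y => Φ y ξ) (fun y => Φ y ζ) (ι s) = 0) :
    finrank ℝ EN + 2 * finrank ℝ EG = finrank ℝ E := by
  let dι : TangentSpace 𝓘(ℝ, ES) s →ₗ[ℝ] TangentSpace 𝓘(ℝ, E) (ι s) :=
    mfderiv 𝓘(ℝ, ES) 𝓘(ℝ, E) ι s
  let dπ : TangentSpace 𝓘(ℝ, ES) s →ₗ[ℝ] TangentSpace 𝓘(ℝ, EN) (π s) :=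
    mfderiv 𝓘(ℝ, ES) 𝓘(ℝ, EN) π s
  have hmap : (LinearMap.ker dπ).map dι = (momentSpan hΦ (ι s)).map (Ω.sharp (ι s)) := by
    refine le_antisymm ?_ ?_
    · rintro _ ⟨u, hu, rfl⟩
      obtain ⟨γ, hγ⟩ := Ω.sharp_surjective (ι s) (dι u)
      refine ⟨γ, ?_, hγ⟩
      rw [SetLike.mem_coe, ← hι.ker_pullbackCotangent hΦ hfree s, LinearMap.mem_ker]
      ext w
      rw [pullbackCotangent_apply, ← Ω.form_sharp, hγ]
      have h0 : mfderiv 𝓘(ℝ, ES) 𝓘(ℝ, EN) π s u = 0 := hu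
      have h1 := hπ.pullback s w u
      rw [h0, map_zero] at h1
      exact h1.symm
    · rintro _ ⟨γ, hγ, rfl⟩
      obtain ⟨u, hu⟩ : Ω.sharp (ι s) γ ∈ LinearMap.range dι :=
        (hι.range_mfderiv hΦ hfree s).ge
          (Submodule.mem_map_of_mem (momentSpan_le_orthogonal hΦ hcomm hγ))
      refine ⟨u, ?_, hu⟩
      have hγ' : pullbackCotangent ES E ι s γ = 0 := by
        rw [← LinearMap.mem_ker, hι.ker_pullbackCotangent hΦ hfree s]
        exact hγ
      have h1 := hπ.mfderiv_eq_sharp (b := 0) hu ((map_zero _).trans hγ'.symm)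
      exact h1.trans (map_zero _)
  have h1 : finrank ℝ (LinearMap.ker dπ) = finrank ℝ EG := by
    rw [← finrank_map_of_injective (J := dι) (hι.immersion s), hmap,
      finrank_map_of_injective (Ω.sharp_injective _), finrank_momentSpan hΦ hfree]
  have h2 := LinearMap.finrank_range_add_finrank_ker dπ
  rw [LinearMap.range_eq_top.2 (hπ.submersion s), finrank_top, h1] at h2
  have h3 : finrank ℝ EN + finrank ℝ EG = finrank ℝ ES := h2
  have h4 := hι.finrank_add
  omega

theorem isOpenMap_moment (hΦ : IsHamiltonianAction Ω Φ)
    (hfree : ∀ (g : G) (x : M), g • x = x → g = 1) : Continuous Φ ∧ IsOpenMap Φ :=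
  isOpenMap_of_surjective_differential (V := EG) hΦ.smooth
    (surjective_differential_moment hΦ hfree)

theorem IsMomentLevel.dense_preimage (hι : IsMomentLevel (E := E) (ES := ES) Φ η ι) {U : Set M}
    (h : ∀ x, Φ x = η → ∀ O ∈ nhds x, ∃ x' ∈ O ∩ U, Φ x' = η) : Dense (ι ⁻¹' U) := by
  intro s
  refine mem_closure_iff_nhds.2 fun W hW => ?_
  rw [hι.isEmbedding.nhds_eq_comap] at hW
  obtain ⟨O, hO, hOW⟩ := Filter.mem_comap.1 hW
  have hs : ι s ∈ {x | Φ x = η} := hι.range_eq ▸ Set.mem_range_self s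
  obtain ⟨x', ⟨hx'O, hx'U⟩, hx'⟩ := h (ι s) hs O hO
  obtain ⟨s', rfl⟩ : x' ∈ Set.range ι := hι.range_eq ▸ hx'
  exact ⟨s', hOW hx'O, hx'U⟩

end ReducedSpace

/-! ### First integrals of torus-dense systems -/

section TorusDense

open Module Filter Topology

variable {E : Type*} [NormedAddCommGroup E] [NormedSpace ℝ E]
  {M : Type*} [TopologicalSpace M] [ChartedSpace E M] [IsManifold 𝓘(ℝ, E) ∞ M]
  {Ω : SymplecticForm E M} {n : ℕ} {σ : ℝ} {ψ : AngleAction n → M}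
  {H : EuclideanSpace ℝ (Fin n) → ℝ}

theorem isOpen_toroidalCover (n : ℕ) (σ : ℝ) : IsOpen (toroidalCover n σ) :=
  Metric.isOpen_ball.preimage continuous_snd

namespace IsActionAngle

theorem contMDiffAt {h : M → ℝ} (hψ : IsActionAngle Ω h σ ψ H) {z : AngleAction n}
    (hz : z ∈ toroidalCover n σ) : ContMDiffAt 𝓘(ℝ, AngleAction n) 𝓘(ℝ, E) ∞ ψ z :=
  hψ.contMDiffOn.contMDiffAt ((isOpen_toroidalCover n σ).mem_nhds hz)

theorem contDiffAt_comp {h : M → ℝ} (hψ : IsActionAngle Ω h σ ψ H) {z : AngleAction n}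
    (hz : z ∈ toroidalCover n σ) (f : C^∞⟮𝓘(ℝ, E), M; ℝ⟯) : ContDiffAt ℝ ∞ (fun w => f (ψ w)) z :=
  ((f.contMDiff _).comp z (hψ.contMDiffAt hz)).contDiffAt

theorem differential_mfderiv {h : M → ℝ} (hψ : IsActionAngle Ω h σ ψ H) {z : AngleAction n}
    (hz : z ∈ toroidalCover n σ) (f : C^∞⟮𝓘(ℝ, E), M; ℝ⟯) (u : AngleAction n) :
    differential (E := E) f (ψ z) (mfderiv 𝓘(ℝ, AngleAction n) 𝓘(ℝ, E) ψ z u) =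
      fderiv ℝ (fun w => f (ψ w)) z u := by
  refine (differential_comp (f.mdifferentiable_real _)
    ((hψ.contMDiffAt hz).mdifferentiableAt (by simp)) u).symm.trans ?_
  rw [← mfderiv_eq_fderiv]
  rfl

/-- The form pulls back to a nondegenerate one, so the derivative is injective, and the dimensions
agree. -/
theorem mfderiv_surjective [FiniteDimensional ℝ E] {h : M → ℝ} (hψ : IsActionAngle Ω h σ ψ H)
    (hdim : finrank ℝ E = 2 * n) {z : AngleAction n} (hz : z ∈ toroidalCover n σ) :
    Function.Surjective (mfderiv 𝓘(ℝ, AngleAction n) 𝓘(ℝ, E) ψ z) := by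
  let D : AngleAction n →L[ℝ] E := mfderiv 𝓘(ℝ, AngleAction n) 𝓘(ℝ, E) ψ z
  let L : AngleAction n →ₗ[ℝ] E := D
  have hfr : finrank ℝ (AngleAction n) = finrank ℝ E := by
    rw [finrank_prod, finrank_euclideanSpace, Fintype.card_fin, hdim, two_mul]
  have hinj : Function.Injective L := by
    refine (injective_iff_map_eq_zero L).2 fun u hu => ?_
    have h0 : ∀ v : AngleAction n, ∑ i, (u.2 i * v.1 i - v.2 i * u.1 i) = 0 := fun v => by
      rw [← hψ.canonical z hz u v]
      have : mfderiv 𝓘(ℝ, AngleAction n) 𝓘(ℝ, E) ψ z u = 0 := hu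
      rw [this, map_zero]
      rfl
    refine Prod.ext ?_ ?_
    · ext i
      have := h0 (0, EuclideanSpace.single i 1)
      simpa [Finset.sum_ite_eq, Pi.single_apply] using this
    · ext i
      have := h0 (EuclideanSpace.single i 1, 0)
      simpa [Finset.sum_ite_eq, Pi.single_apply] using this
  have hsurj : Function.Surjective L :=
    (LinearMap.injective_iff_surjective_of_finrank_eq_finrank hfr).1 hinj
  exact hsurj

theorem hamiltonianField_eq [FiniteDimensional ℝ E] {h : C^∞⟮𝓘(ℝ, E), M; ℝ⟯}
    (hψ : IsActionAngle Ω h σ ψ H) (hdim : finrank ℝ E = 2 * n) {z : AngleAction n}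
    (hz : z ∈ toroidalCover n σ) :
    Ω.hamiltonianField h (ψ z) = mfderiv 𝓘(ℝ, AngleAction n) 𝓘(ℝ, E) ψ z
      ((WithLp.toLp 2 (frequency H z.2), 0) : AngleAction n) := by
  refine Ω.eq_of_form_eq fun w => ?_
  obtain ⟨u, rfl⟩ := hψ.mfderiv_surjective hdim hz w
  let u' : AngleAction n := u
  rw [Ω.form_hamiltonianField]
  refine (hψ.differential_mfderiv hz h u').trans
    (Eq.trans ?_ (hψ.canonical z hz u' (WithLp.toLp 2 (frequency H z.2), 0)).symm)
  have hev : (fun w => h (ψ w)) =ᶠ[𝓝 z] fun w => H w.2 := by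
    filter_upwards [(isOpen_toroidalCover n σ).mem_nhds hz] with w hw
    exact hψ.hamiltonian w hw
  -- No regularity of `H` is assumed; it is inherited from `h ∘ ψ` at fixed angles.
  have hH : DifferentiableAt ℝ H z.2 := by
    have h1 : DifferentiableAt ℝ (fun I => h (ψ (z.1, I))) z.2 :=
      DifferentiableAt.comp (g := fun w => h (ψ w)) (f := fun I => ((z.1, I) : AngleAction n)) z.2
        ((hψ.contDiffAt_comp hz h).differentiableAt (by simp)) ((differentiableAt_const z.1).prodMk differentiableAt_id)
    refine h1.congr_of_eventuallyEq ?_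
    have hz' : z.2 ∈ Metric.ball 0 σ := hz
    filter_upwards [Metric.isOpen_ball.mem_nhds hz'] with I hI
    exact (hψ.hamiltonian (z.1, I) hI).symm
  have h2 : HasFDerivAt (fun w : AngleAction n => H w.2)
      ((fderiv ℝ H z.2).comp (ContinuousLinearMap.snd ℝ _ _)) z :=
    hH.hasFDerivAt.comp z hasFDerivAt_snd
  rw [hev.fderiv_eq, h2.fderiv]
  have h3 : u'.2 = ∑ i, u'.2 i • EuclideanSpace.single i (1 : ℝ) := by
    ext j
    simp [Pi.single_apply]
  have h4 : fderiv ℝ H z.2 u'.2 = ∑ i, u'.2 i * frequency H z.2 i := by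
    conv_lhs => rw [h3]
    simp [frequency]
  simpa using h4

/-- A first integral of a torus-dense system is constant on the invariant tori. -/
theorem integral_eq_of_isTorusDense [FiniteDimensional ℝ E] {h : C^∞⟮𝓘(ℝ, E), M; ℝ⟯}
    (hψ : IsActionAngle Ω h σ ψ H) (hdim : finrank ℝ E = 2 * n) (hT : IsTorusDense σ H)
    {f : C^∞⟮𝓘(ℝ, E), M; ℝ⟯} (hf : IsFirstIntegral Ω.bivector h f)
    {I : EuclideanSpace ℝ (Fin n)} (hI : I ∈ Metric.ball 0 σ) (φ φ' : EuclideanSpace ℝ (Fin n)) :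
    f (ψ (φ, I)) = f (ψ (φ', I)) := by
  have htraj : ∀ I ∈ Metric.ball (0 : EuclideanSpace ℝ (Fin n)) σ, ∀ φ (t : ℝ),
      f (ψ (φ + t • WithLp.toLp 2 (frequency H I), I)) = f (ψ (φ, I)) := by
    intro I hI φ t
    set ν : EuclideanSpace ℝ (Fin n) := WithLp.toLp 2 (frequency H I)
    have hd : ∀ t : ℝ, HasDerivAt (fun t : ℝ => f (ψ (φ + t • ν, I))) 0 t := fun t => by
      have hz : ((φ + t • ν, I) : AngleAction n) ∈ toroidalCover n σ := hI
      have h1 := ((hψ.contDiffAt_comp hz f).differentiableAt (by simp)).hasFDerivAt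
      have h2 : HasDerivAt (fun t : ℝ => ((φ + t • ν, I) : AngleAction n)) (ν, 0) t :=
        (((hasDerivAt_id t).smul_const ν).const_add φ |>.congr_deriv (one_smul ℝ ν)).prodMk
          (hasDerivAt_const t I)
      have h3 := h1.comp_hasDerivAt t h2
      rwa [← hψ.differential_mfderiv hz f, ← hψ.hamiltonianField_eq hdim hz,
        show differential (E := E) f (ψ (φ + t • ν, I)) (Ω.hamiltonianField h _) = 0 from
          hf _] at h3
    have := is_const_of_deriv_eq_zero (fun t => (hd t).differentiableAt)
      (fun t => (hd t).deriv) t 0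
    simpa using this
  have hdense : ∀ I ∈ {I₀ ∈ Metric.ball 0 σ | ∀ φ₀ : Fin n → ℝ,
      Dense (Set.range fun (t : ℝ) (i : Fin n) =>
        ((φ₀ i + t * frequency H I₀ i : ℝ) : AddCircle (2 * Real.pi)))}, ∀ φ φ',
      f (ψ (φ, I)) = f (ψ (φ', I)) := by
    rintro I ⟨hI, hID⟩ φ φ'
    -- The projection onto the torus is open, so the preimage of a dense trajectory is dense in the
    -- space of angles, where `f ∘ ψ` is continuous.
    let Q : (Fin n → ℝ) → Fin n → AddCircle (2 * Real.pi) := Pi.map fun _ x => (x : AddCircle _)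
    have hQ : IsOpenMap Q := IsOpenMap.piMap (fun _ => QuotientAddGroup.isOpenMap_coe)
      (Filter.Eventually.of_forall fun _ => QuotientAddGroup.mk_surjective)
    have hD := (hID φ').preimage hQ
    have hc : Continuous fun θ : Fin n → ℝ => f (ψ (WithLp.toLp 2 θ, I)) := by
      refine continuous_iff_continuousAt.2 fun θ => ?_
      have hz : ((WithLp.toLp 2 θ, I) : AngleAction n) ∈ toroidalCover n σ := hI
      refine ContinuousAt.comp (f := fun θ : Fin n → ℝ => ((WithLp.toLp 2 θ, I) : AngleAction n))
        (hψ.contDiffAt_comp hz f).continuousAt ?_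
      exact ((PiLp.continuous_toLp 2 _).prodMk continuous_const).continuousAt
    have heq : (fun θ : Fin n → ℝ => f (ψ (WithLp.toLp 2 θ, I))) = fun _ => f (ψ (φ', I)) := by
      refine Continuous.ext_on hD hc continuous_const ?_
      rintro θ ⟨t, ht⟩
      rw [← htraj I hI φ' t]
      refine congrArg f ((hψ.eq_iff (WithLp.toLp 2 θ, I) hI (_, I) hI).2 ⟨rfl, ?_⟩)
      have hk : ∀ i, ∃ k : ℤ, φ' i + t * frequency H I i = θ i + 2 * Real.pi * k := fun i => by
        have hti : ((φ' i + t * frequency H I i : ℝ) : AddCircle (2 * Real.pi)) = (θ i : ℝ) :=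
          congrFun ht i
        obtain ⟨k, hk⟩ := (QuotientAddGroup.eq_iff_sub_mem.1 hti)
        refine ⟨k, ?_⟩
        simp only [zsmul_eq_mul] at hk
        linarith
      choose k hk using hk
      exact ⟨k, hk⟩
    exact congrFun heq (WithLp.ofLp φ)
  -- Tori with dense trajectories occur for a dense set of actions; continuity in `I` at fixed
  -- angles carries the equality to all tori.
  have hcl := hT hI
  rw [mem_closure_iff_nhdsWithin_neBot] at hcl
  have hcont : ∀ φ : EuclideanSpace ℝ (Fin n), ContinuousAt (fun I => f (ψ (φ, I))) I := fun φ => by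
    have hz : ((φ, I) : AngleAction n) ∈ toroidalCover n σ := hI
    exact ContinuousAt.comp (f := fun I => ((φ, I) : AngleAction n))
      (hψ.contDiffAt_comp hz f).continuousAt (Continuous.prodMk_right φ).continuousAt
  refine @tendsto_nhds_unique _ _ _ _ _ _ _ _ hcl
    ((hcont φ).tendsto.mono_left nhdsWithin_le_nhds)
    (((hcont φ').tendsto.mono_left nhdsWithin_le_nhds).congr' ?_)
  filter_upwards [self_mem_nhdsWithin] with I hI
  exact (hdense I hI φ φ').symm

/-- First integrals of a torus-dense system commute in toroidal domains. -/
theorem poissonBracket_eq_zero_of_isTorusDense [FiniteDimensional ℝ E]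
    {h : C^∞⟮𝓘(ℝ, E), M; ℝ⟯} (hψ : IsActionAngle Ω h σ ψ H) (hdim : finrank ℝ E = 2 * n)
    (hT : IsTorusDense σ H) {f g : C^∞⟮𝓘(ℝ, E), M; ℝ⟯} (hf : IsFirstIntegral Ω.bivector h f)
    (hg : IsFirstIntegral Ω.bivector h g) {z : AngleAction n} (hz : z ∈ toroidalCover n σ) :
    poissonBracket Ω.bivector f g (ψ z) = 0 := by
  have hzero : ∀ f : C^∞⟮𝓘(ℝ, E), M; ℝ⟯, IsFirstIntegral Ω.bivector h f →
      ∀ w : EuclideanSpace ℝ (Fin n), differential (E := E) f (ψ z)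
        (mfderiv 𝓘(ℝ, AngleAction n) 𝓘(ℝ, E) ψ z ((w, 0) : AngleAction n)) = 0 := by
    intro f hf w
    rw [hψ.differential_mfderiv hz]
    have h1 := ((hψ.contDiffAt_comp hz f).differentiableAt (by simp)).hasFDerivAt
    have h2 : HasFDerivAt (fun φ => ((φ, z.2) : AngleAction n))
        (ContinuousLinearMap.inl ℝ _ _) z.1 := hasFDerivAt_prodMk_left z.1 z.2
    have h3 : HasFDerivAt (fun φ => f (ψ (φ, z.2)))
      ((fderiv ℝ (fun w => f (ψ w)) z).comp (ContinuousLinearMap.inl ℝ _ _)) z.1 :=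
      HasFDerivAt.comp (g := fun w => f (ψ w)) (f := fun φ => ((φ, z.2) : AngleAction n)) z.1 h1 h2
    have h4 : (fun φ => f (ψ (φ, z.2))) = fun _ => f (ψ z) :=
      funext fun φ => hψ.integral_eq_of_isTorusDense hdim hT hf hz φ z.1
    rw [h4] at h3
    exact DFunLike.congr_fun (h3.unique (hasFDerivAt_const _ _)) w
  obtain ⟨w, hw⟩ := hψ.mfderiv_surjective hdim hz (Ω.hamiltonianField g (ψ z))
  let w' : AngleAction n := w
  -- The canonical form pairs angle directions with action components. As `dg` vanishes on angle
  -- directions, the Hamiltonian vector of `g` has no action component, and `df` kills what remains.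
  have hw2 : w'.2 = 0 := by
    ext i
    have h1 := hzero g hg (EuclideanSpace.single i 1)
    rw [← Ω.form_hamiltonianField, ← hw] at h1
    have h2 := (hψ.canonical z hz (EuclideanSpace.single i 1, 0) w').symm.trans h1
    simpa [Pi.single_apply] using h2
  have hw' : w' = (w'.1, 0) := Prod.ext rfl hw2
  have h5 := hzero f hf w'.1
  rw [← hw'] at h5
  exact (congrArg (differential (E := E) f (ψ z)) hw).symm.trans h5

end IsActionAngle

end TorusDense

/-! ### Integrability of the reduced systems -/

section Integrability

open Module Filter

variable {EG : Type*} [NormedAddCommGroup EG] [NormedSpace ℝ EG] [FiniteDimensional ℝ EG]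
  {G : Type*} [TopologicalSpace G] [ChartedSpace EG G] [Group G] [LieGroup 𝓘(ℝ, EG) ∞ G]
  {E : Type*} [NormedAddCommGroup E] [NormedSpace ℝ E] [FiniteDimensional ℝ E]
  {M : Type*} [TopologicalSpace M] [ChartedSpace E M] [IsManifold 𝓘(ℝ, E) ∞ M]
  [MulAction G M] [ContMDiffSMul 𝓘(ℝ, EG) 𝓘(ℝ, E) ∞ G M]
  {Ω : SymplecticForm E M} {Φ : M → LieDual EG G} {h : C^∞⟮𝓘(ℝ, E), M; ℝ⟯}

/-- Integrability by invariant integrals forces the components of the moment map to commute. -/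
theorem poissonBracket_moment_eq_zero_of_integrable (hΦ : IsHamiltonianAction Ω Φ)
    (hint : IsNoncommutativelyIntegrable Ω.bivector h (invariantFunctions G E M) ∨
      IsLiouvilleIntegrable Ω.bivector h (invariantFunctions G E M))
    (ξ ζ : GroupLieAlgebra 𝓘(ℝ, EG) G) (x : M) :
    poissonBracket Ω.bivector (fun y => Φ y ξ) (fun y => Φ y ζ) x = 0 := by
  rcases hint with ⟨F, -, ⟨l, r, U, -, hUd, hU⟩, hF⟩ | ⟨N, f, U, hf, hA⟩
  · refine poissonBracket_moment_eq_zero_of_complete hΦ (fun f hf => (hF f hf).1) hUd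
      (fun x hx => ?_) ξ ζ x
    obtain ⟨h₁, h₂, h₃⟩ := hU x hx
    rw [h₁, h₂, h₃, Ω.corank_bivector, add_zero]
  · refine poissonBracket_moment_eq_zero_of_complete hΦ (Set.range_subset_iff.2 hA) hf.dense
      (fun x hx => ?_) ξ ζ x
    rw [hf.finrank_add hx, Ω.corank_bivector, add_zero]

section OrbitManifold

variable {EB : Type*} [NormedAddCommGroup EB] [NormedSpace ℝ EB] [FiniteDimensional ℝ EB]
  {B : Type*} [TopologicalSpace B] [ChartedSpace EB B] [IsManifold 𝓘(ℝ, EB) ∞ B] [T2Space B]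
  {p : M → B} {ΛB : BivectorField EB B} {HB : C^∞⟮𝓘(ℝ, EB), B; ℝ⟯}

theorem IsOrbitManifold.finrank_add_corank (hp : IsOrbitManifold (E := E) (EB := EB) EG G p)
    (hΛ : IsReducedPoisson Ω p ΛB) (hΦ : IsHamiltonianAction Ω Φ)
    (hfree : ∀ (g : G) (x : M), g • x = x → g = 1)
    (hint : IsNoncommutativelyIntegrable Ω.bivector h (invariantFunctions G E M) ∨
      IsLiouvilleIntegrable Ω.bivector h (invariantFunctions G E M)) (x : M) :
    finrank ℝ EB + corank ΛB (p x) + 2 * 0 = finrank ℝ E + corank Ω.bivector (id x) := by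
  rw [hp.corank_eq hΛ hΦ hfree x
    (fun ξ ζ => poissonBracket_moment_eq_zero_of_integrable hΦ hint ξ ζ x), Ω.corank_bivector]
  exact hp.finrank_add

theorem IsOrbitManifold.isNoncommutativelyIntegrable
    (hp : IsOrbitManifold (E := E) (EB := EB) EG G p)
    (hΛ : IsReducedPoisson Ω p ΛB) (hΦ : IsHamiltonianAction Ω Φ)
    (hfree : ∀ (g : G) (x : M), g • x = x → g = 1) (hinv : h ∈ invariantFunctions G E M)
    (hH : ∀ x, h x = HB (p x))
    (hint : IsNoncommutativelyIntegrable Ω.bivector h (invariantFunctions G E M)) :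
    IsNoncommutativelyIntegrable ΛB HB Set.univ := by
  have hdim := hp.finrank_add_corank hΛ hΦ hfree (Or.inl hint)
  obtain ⟨F, hcl, ⟨l, r, U, hUo, hUd, hU⟩, hF⟩ := hint
  refine (hp.isReduction hΛ).isNoncommutativelyIntegrable hinv (fun x => (hH x).symm) hcl hF hUo
    hUd (fun x hx => (hU x hx).1) (fun x hx => (hU x hx).2.1) (fun x hx => (hU x hx).2.2)
    (fun x _ => ?_) (fun x => ?_) hdim
  · exact (ker_pullbackCotangent_id x).le.trans bot_le
  · exact (congrArg (fun P : Submodule ℝ (Cotangent E x) => finrank ℝ P)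
      (ker_pullbackCotangent_id x)).trans (finrank_bot ℝ _)

theorem IsOrbitManifold.isLiouvilleIntegrable [SecondCountableTopology B]
    (hp : IsOrbitManifold (E := E) (EB := EB) EG G p)
    (hΛ : IsReducedPoisson Ω p ΛB) (hΦ : IsHamiltonianAction Ω Φ)
    (hfree : ∀ (g : G) (x : M), g • x = x → g = 1) (hinv : h ∈ invariantFunctions G E M)
    (hH : ∀ x, h x = HB (p x))
    (hint : IsLiouvilleIntegrable Ω.bivector h (invariantFunctions G E M)) :
    IsLiouvilleIntegrable ΛB HB Set.univ := by
  have hdim := hp.finrank_add_corank hΛ hΦ hfree (Or.inr hint)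
  obtain ⟨n, f, U, hf, hA⟩ := hint
  refine (hp.isReduction hΛ).isLiouvilleIntegrable hinv (fun x => (hH x).symm) hf hA hf.dense
    (fun x _ => ?_) (fun x => ?_) hdim
  · exact (ker_pullbackCotangent_id x).le.trans bot_le
  · exact (congrArg (fun P : Submodule ℝ (Cotangent E x) => finrank ℝ P)
      (ker_pullbackCotangent_id x)).trans (finrank_bot ℝ _)

end OrbitManifold

section ReducedSpace

variable {η : LieDual EG G}
  {ES : Type*} [NormedAddCommGroup ES] [NormedSpace ℝ ES] [FiniteDimensional ℝ ES]
  {S : Type*} [TopologicalSpace S] [ChartedSpace ES S] [IsManifold 𝓘(ℝ, ES) ∞ S]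
  {EN : Type*} [NormedAddCommGroup EN] [NormedSpace ℝ EN] [FiniteDimensional ℝ EN]
  {N : Type*} [TopologicalSpace N] [ChartedSpace EN N] [IsManifold 𝓘(ℝ, EN) ∞ N]
  {ι : S → M} {π : S → N} {ΩN : SymplecticForm EN N} {HN : C^∞⟮𝓘(ℝ, EN), N; ℝ⟯}

theorem IsReducedSpace.finrank_add_corank
    (hπ : IsReducedSpace (E := E) (ES := ES) Ω η ι π ΩN)
    (hι : IsMomentLevel (E := E) (ES := ES) Φ η ι) (hΦ : IsHamiltonianAction Ω Φ)
    (hfree : ∀ (g : G) (x : M), g • x = x → g = 1)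
    (hint : IsNoncommutativelyIntegrable Ω.bivector h (invariantFunctions G E M) ∨
      IsLiouvilleIntegrable Ω.bivector h (invariantFunctions G E M)) (s : S) :
    finrank ℝ EN + corank ΩN.bivector (π s) + 2 * finrank ℝ EG =
      finrank ℝ E + corank Ω.bivector (ι s) := by
  rw [ΩN.corank_bivector, Ω.corank_bivector]
  exact hπ.finrank_add hι hΦ hfree s
    fun ξ ζ => poissonBracket_moment_eq_zero_of_integrable hΦ hint ξ ζ (ι s)

/-- The algebra and the set `U` enter as data because the fibre condition on `η` refers to this
particular `U`. -/
theorem IsReducedSpace.isNoncommutativelyIntegrable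
    (hπ : IsReducedSpace (E := E) (ES := ES) Ω η ι π ΩN)
    (hι : IsMomentLevel (E := E) (ES := ES) Φ η ι) (hΦ : IsHamiltonianAction Ω Φ)
    (hfree : ∀ (g : G) (x : M), g • x = x → g = 1) (hinv : h ∈ invariantFunctions G E M)
    (hH : ∀ s, h (ι s) = HN (π s)) {F : Subalgebra ℝ C^∞⟮𝓘(ℝ, E), M; ℝ⟯}
    (hclosed : IsPoissonClosed Ω.bivector F)
    (hF : ∀ f ∈ F, f ∈ invariantFunctions G E M ∧ IsFirstIntegral Ω.bivector h f) {l r : ℕ}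
    {U : Set M} (hUo : IsOpen U) (hUd : Dense U)
    (hU : ∀ x ∈ U, finrank ℝ (differentialSpan (F : Set C^∞⟮𝓘(ℝ, E), M; ℝ⟯) x) = l ∧
      finrank ℝ (differentialKernel Ω.bivector F x) = r ∧
      l + r = finrank ℝ E + corank Ω.bivector x)
    (hfib : ∀ x, Φ x = η → ∀ O ∈ nhds x, ∃ x' ∈ O ∩ U, Φ x' = η) :
    IsNoncommutativelyIntegrable ΩN.bivector HN Set.univ := by
  have hdim := hπ.finrank_add_corank hι hΦ hfree
    (Or.inl ⟨F, hclosed, ⟨l, r, U, hUo, hUd, hU⟩, hF⟩)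
  refine (hπ.isReduction hι hΦ hfree).isNoncommutativelyIntegrable hinv (fun s => (hH s).symm)
    hclosed hF hUo (hι.dense_preimage hfib) (fun x hx => (hU x hx).1) (fun x hx => (hU x hx).2.1)
    (fun x hx => (hU x hx).2.2) (fun s hs => ?_) (fun s => ?_) hdim
  · rw [hι.ker_pullbackCotangent hΦ hfree]
    refine momentSpan_le_differentialKernel hΦ (fun f hf => (hF f hf).1) ?_
    obtain ⟨h₁, h₂, h₃⟩ := hU _ hs
    rw [h₁, h₂, h₃, Ω.corank_bivector, add_zero]
  · rw [hι.ker_pullbackCotangent hΦ hfree, finrank_momentSpan hΦ hfree]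

theorem IsReducedSpace.isLiouvilleIntegrable [SecondCountableTopology N]
    (hπ : IsReducedSpace (E := E) (ES := ES) Ω η ι π ΩN)
    (hι : IsMomentLevel (E := E) (ES := ES) Φ η ι) (hΦ : IsHamiltonianAction Ω Φ)
    (hfree : ∀ (g : G) (x : M), g • x = x → g = 1) (hinv : h ∈ invariantFunctions G E M)
    (hH : ∀ s, h (ι s) = HN (π s)) {n : ℕ} {f : Fin n → C^∞⟮𝓘(ℝ, E), M; ℝ⟯} {U : Set M}
    (hf : IsCompleteInvolutive Ω.bivector h f U) (hA : ∀ i, f i ∈ invariantFunctions G E M)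
    (hfib : ∀ x, Φ x = η → ∀ O ∈ nhds x, ∃ x' ∈ O ∩ U, Φ x' = η) :
    IsLiouvilleIntegrable ΩN.bivector HN Set.univ := by
  have hdim := hπ.finrank_add_corank hι hΦ hfree (Or.inr ⟨n, f, U, hf, hA⟩)
  refine (hπ.isReduction hι hΦ hfree).isLiouvilleIntegrable hinv (fun s => (hH s).symm) hf hA
    (hι.dense_preimage hfib) (fun s hs => ?_) (fun s => ?_) hdim
  · rw [hι.ker_pullbackCotangent hΦ hfree]
    refine (momentSpan_le_differentialKernel hΦ (Set.range_subset_iff.2 hA) ?_).trans inf_le_left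
    rw [hf.finrank_add hs, Ω.corank_bivector, add_zero]
  · rw [hι.ker_pullbackCotangent hΦ hfree, finrank_momentSpan hΦ hfree]

end ReducedSpace

/-- Torus-dense integrability forces the components of the moment map to commute. -/
theorem poissonBracket_moment_eq_zero_of_isTorusDenseIntegrable {n : ℕ}
    (hdim : finrank ℝ E = 2 * n) (hΦ : IsHamiltonianAction Ω Φ)
    (hinv : h ∈ invariantFunctions G E M) (hint : IsTorusDenseIntegrable Ω h n)
    (ξ ζ : GroupLieAlgebra 𝓘(ℝ, EG) G) (x : M) :
    poissonBracket Ω.bivector (fun y => Φ y ξ) (fun y => Φ y ζ) x = 0 := by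
  obtain ⟨f, U, hf, hU⟩ := hint
  -- Noether's theorem: invariance of `h` gives `{h, φ_ξ} = 0`, and the bracket is skew.
  have hfirst : ∀ ξ, IsFirstIntegral Ω.bivector h (momentFunction hΦ ξ) := fun ξ x =>
    Ω.bivector_isRefl x _ _
      (differential_hamiltonianField_of_invariant hΦ h.mdifferentiable_real hinv x ξ)
  refine poissonBracket_moment_eq_zero_of_dense hΦ hf.dense (fun x hx ξ ζ => ?_) ξ ζ x
  obtain ⟨σ, ψ, H, hψ, ⟨z, hz, rfl⟩, hT⟩ := hU x hx
  exact hψ.poissonBracket_eq_zero_of_isTorusDense hdim hT (hfirst ξ) (hfirst ζ) hz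

end Integrability

end

/-! ### The lemma itself -/

theorem lemma5p1
    -- the connected Lie group `G`
    {EG : Type*} [NormedAddCommGroup EG] [NormedSpace ℝ EG] [FiniteDimensional ℝ EG]
    {G : Type*} [TopologicalSpace G] [ChartedSpace EG G] [Group G] [LieGroup 𝓘(ℝ, EG) ∞ G]
    [T2Space G] [ConnectedSpace G]
    -- the symplectic manifold `(M, Ω)` of dimension `2n`
    {n : ℕ}
    {E : Type*} [NormedAddCommGroup E] [NormedSpace ℝ E] [FiniteDimensional ℝ E]
    (hdim : Module.finrank ℝ E = 2 * n)
    {M : Type*} [TopologicalSpace M] [ChartedSpace E M] [IsManifold 𝓘(ℝ, E) ∞ M]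
    [T2Space M] [SecondCountableTopology M]
    (Ω : SymplecticForm E M)
    -- the effective Hamiltonian action and the invariant Hamiltonian
    [MulAction G M] [ContMDiffSMul 𝓘(ℝ, EG) 𝓘(ℝ, E) ∞ G M] [FaithfulSMul G M]
    (Φ : M → LieDual EG G) (hΦ : IsHamiltonianAction Ω Φ)
    (h : C^∞⟮𝓘(ℝ, E), M; ℝ⟯) (hinv : h ∈ invariantFunctions G E M) :
    -- (i) integrability by invariant integrals forces `G` to be commutative
    ((IsNoncommutativelyIntegrable Ω.bivector h (invariantFunctions G E M) ∨
        IsLiouvilleIntegrable Ω.bivector h (invariantFunctions G E M)) →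
      ∀ a b : G, a * b = b * a) ∧
    -- (i) if the action is free, the reduced systems are completely integrable
    ((∀ (g : G) (x : M), g • x = x → g = 1) →
      -- the reduced system on the Poisson manifold `B = M / G`
      (∀ {EB : Type*} [NormedAddCommGroup EB] [NormedSpace ℝ EB] [FiniteDimensional ℝ EB]
        {B : Type*} [TopologicalSpace B] [ChartedSpace EB B] [IsManifold 𝓘(ℝ, EB) ∞ B]
        [T2Space B] [SecondCountableTopology B]
        (p : M → B) (ΛB : BivectorField EB B) (HB : C^∞⟮𝓘(ℝ, EB), B; ℝ⟯),
        IsOrbitManifold (E := E) (EB := EB) EG G p → IsReducedPoisson Ω p ΛB → (∀ x, h x = HB (p x)) →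
        (IsNoncommutativelyIntegrable Ω.bivector h (invariantFunctions G E M) →
          IsNoncommutativelyIntegrable ΛB HB Set.univ) ∧
        (IsLiouvilleIntegrable Ω.bivector h (invariantFunctions G E M) →
          IsLiouvilleIntegrable ΛB HB Set.univ)) ∧
      -- the reduced system on `N = N_η = M_η / G_η`, for generic `η`
      (∀ᶠ η : LieDual EG G in residual (LieDual EG G),
        ∀ {ES : Type*} [NormedAddCommGroup ES] [NormedSpace ℝ ES] [FiniteDimensional ℝ ES]
        {S : Type*} [TopologicalSpace S] [ChartedSpace ES S] [IsManifold 𝓘(ℝ, ES) ∞ S]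
        {EN : Type*} [NormedAddCommGroup EN] [NormedSpace ℝ EN] [FiniteDimensional ℝ EN]
        {N : Type*} [TopologicalSpace N] [ChartedSpace EN N] [IsManifold 𝓘(ℝ, EN) ∞ N]
        [T2Space N] [SecondCountableTopology N]
        (ι : S → M) (π : S → N) (ΩN : SymplecticForm EN N) (HN : C^∞⟮𝓘(ℝ, EN), N; ℝ⟯),
        IsMomentLevel (E := E) (ES := ES) Φ η ι → IsReducedSpace (E := E) (ES := ES) Ω η ι π ΩN → (∀ s, h (ι s) = HN (π s)) →
        (IsNoncommutativelyIntegrable Ω.bivector h (invariantFunctions G E M) →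
          IsNoncommutativelyIntegrable ΩN.bivector HN Set.univ) ∧
        (IsLiouvilleIntegrable Ω.bivector h (invariantFunctions G E M) →
          IsLiouvilleIntegrable ΩN.bivector HN Set.univ))) ∧
    -- (ii) `𝕋ⁿ`-dense complete integrability forces `G` to be commutative
    (IsTorusDenseIntegrable Ω h n → ∀ a b : G, a * b = b * a) := by
  refine ⟨fun hint => mul_comm_of_moment_commute hΦ
    (poissonBracket_moment_eq_zero_of_integrable hΦ hint), fun hfree => ⟨?_, ?_⟩,
    fun hint => mul_comm_of_moment_commute hΦ
      (poissonBracket_moment_eq_zero_of_isTorusDenseIntegrable hdim hΦ hinv hint)⟩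
  · intro EB _ _ _ B _ _ _ _ _ p ΛB HB hp hΛ hH
    exact ⟨hp.isNoncommutativelyIntegrable hΛ hΦ hfree hinv hH,
      hp.isLiouvilleIntegrable hΛ hΦ hfree hinv hH⟩
  · obtain ⟨hcont, hopen⟩ := isOpenMap_moment hΦ hfree
    -- The residual set must serve all presentations of the reduced space, but it depends on the
    -- dense set `U` of the integrals. So one choice of integrals and `U`, with the fibre condition,
    -- is recorded for each kind of integrability before any reduced space is introduced.
    refine Filter.Eventually.mono (Filter.Eventually.and
      (p := fun η => IsNoncommutativelyIntegrable Ω.bivector h (invariantFunctions G E M) →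
        ∃ (F : Subalgebra ℝ C^∞⟮𝓘(ℝ, E), M; ℝ⟯) (l r : ℕ) (U : Set M),
          IsPoissonClosed Ω.bivector F ∧
          (∀ f ∈ F, f ∈ invariantFunctions G E M ∧ IsFirstIntegral Ω.bivector h f) ∧
          IsOpen U ∧ Dense U ∧
          (∀ x ∈ U, Module.finrank ℝ (differentialSpan (F : Set C^∞⟮𝓘(ℝ, E), M; ℝ⟯) x) = l ∧
            Module.finrank ℝ (differentialKernel Ω.bivector F x) = r ∧
            l + r = Module.finrank ℝ E + corank Ω.bivector x) ∧
          ∀ x, Φ x = η → ∀ O ∈ nhds x, ∃ x' ∈ O ∩ U, Φ x' = η)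
      (q := fun η => IsLiouvilleIntegrable Ω.bivector h (invariantFunctions G E M) →
        ∃ (N : ℕ) (f : Fin N → C^∞⟮𝓘(ℝ, E), M; ℝ⟯) (U : Set M),
          IsCompleteInvolutive Ω.bivector h f U ∧ (∀ i, f i ∈ invariantFunctions G E M) ∧
          ∀ x, Φ x = η → ∀ O ∈ nhds x, ∃ x' ∈ O ∩ U, Φ x' = η) ?_ ?_) ?_
    · by_cases hint : IsNoncommutativelyIntegrable Ω.bivector h (invariantFunctions G E M)
      · obtain ⟨F, hcl, ⟨l, r, U, hUo, hUd, hU⟩, hF⟩ := hint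
        exact (eventually_residual_dense_fibre hcont hopen hUo hUd).mono
          fun η hη _ => ⟨F, l, r, U, hcl, hF, hUo, hUd, hU, hη⟩
      · exact Filter.Eventually.of_forall fun η h' => absurd h' hint
    · by_cases hint : IsLiouvilleIntegrable Ω.bivector h (invariantFunctions G E M)
      · obtain ⟨N, f, U, hf, hA⟩ := hint
        exact (eventually_residual_dense_fibre hcont hopen hf.isOpen hf.dense).mono
          fun η hη _ => ⟨N, f, U, hf, hA, hη⟩
      · exact Filter.Eventually.of_forall fun η h' => absurd h' hint
    · intro η hη ES _ _ _ S _ _ _ EN _ _ _ N _ _ _ _ _ ι π ΩN HN hι hπ hH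
      refine ⟨fun hint => ?_, fun hint => ?_⟩
      · obtain ⟨F, l, r, U, hcl, hF, hUo, hUd, hU, hfib⟩ := hη.1 hint
        exact hπ.isNoncommutativelyIntegrable hι hΦ hfree hinv hH hcl hF hUo hUd hU hfib
      · obtain ⟨n', f, U, hf, hA, hfib⟩ := hη.2 hint
        exact hπ.isLiouvilleIntegrable hι hΦ hfree hinv hH hf hA hfib
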